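/- Let $G$ be a finite simple connected graph with edge set $E(G)=\{e_1,\dots,e_m\}$, let $\mathbb K$ be a field, and let $I_G\subset\mathbb K[e_1,\dots,e_m]$ be the toric ideal of $G$: the ideal generated by all $e^{u}-e^{v}$, $u,v\in\mathbb N^m$, with $\sum_i u_i a_{e_i}=\sum_i v_i a_{e_i}$, where $a_e=x+y$ in the free abelian group on the vertices for $e=\{x,y\}$. A binomial is a polynomial with exactly two terms. A minimal system of binomial generators of $I_G$ is a set of binomials that generates $I_G$ and has no proper subset generating $I_G$. A binomial $B\in I_G$ is *indispensable* if every minimal system of binomial generators of $I_G$ contains a nonzero constant multiple of $B$. For an even closed walk $w=(\epsilon_1,\dots,\epsilon_{2q})$, $\epsilon_k=\{v_k,v_{k+1}\}\in E(G)$, $v_{2q+1}=v_1$, put $E^+(w)=\prod_{k=1}^q\epsilon_{2k-1}$, $E^-(w)=\prod_{k=1}^q\epsilon_{2k}$ and $B_w=E^+(w)-E^-(w)$. Let $\mathbf w$ be the subgraph of $G$ formed by the vertices and edges of $w$. A *block* of $\mathbf w$ is a maximal connected subgraph of $\mathbf w$ without a cut vertex (of itself); a block is *cyclic* if it is a cycle.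 * $w$ is *primitive* if there is no nonempty even closed walk $\xi$ of smaller length than $w$ with $E^+(\xi)\mid E^+(w)$ and $E^-(\xi)\mid E^-(w)$. * A *sink* of a block $B$ is a common vertex of two edges of the walk, $\epsilon_k$ and $\epsilon_l$ with $k\ne l$ and $k\equiv l \pmod 2$, which both belong to $B$. The walk $w$ is *strongly primitive* if it is primitive and no cyclic block of $\mathbf w$ has two sinks that are adjacent in the block. * A *chord* of $w$ is an edge of $G$ that joins two vertices of $\mathbf w$ and is not an edge of $\mathbf w$. It is a *bridge* of $w$ if there are two different blocks $B_1,B_2$ of $\mathbf w$ such that one of its vertices is in $B_1$ and the other in $B_2$. A chord that is not a bridge is *odd* if it can be written as $\{v_s,v_j\}$ with $1\le s<j\le 2q$ and $j-s$ even, so that it breaks $w$ in two odd closed walks. * Two odd chords $f=\{v_s,v_j\}$ and $f'=\{v_{s'},v_{j'}\}$ of $w$, with $1\le s<j\le 2q$, $1\le s'<j'\le 2q$ and $j-s$, $j'-s'$ even, *cross effectively* in $w$ if $s'-s$ is odd and either $s<s'<j<j'$ or $s'<s<j'<j$. **Theorem.** Let $w$ be an even closed walk of $G$ with $B_w\neq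 0$. Then $B_w$ is an indispensable binomial of $I_G$ if and only if $w$ is strongly primitive, all the chords of $w$ are odd, and no two of them cross effectively. -/

import Mathlib

open MvPolynomial SimpleGraph

noncomputable section

namespace GraphToric

/-! ### Toric ideals and indispensable binomials -/

section Toric

variable {σ : Type*} {M : Type*} [AddCommMonoid M]

/-- The `A`-degree `∑ i, u i • a i` of the monomial with exponent vector `u`, where `A` is the
family of vectors `a`. -/
def aDegree (a : σ → M) (u : σ →₀ ℕ) : M :=
  u.sum fun i n => n • a i

/-- The toric ideal of the family `a`: the ideal generated by all binomials `x^u - x^v` whose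
two monomials have the same `A`-degree. -/
def toricIdeal (K : Type*) [Field K] (a : σ → M) : Ideal (MvPolynomial σ K) :=
  Ideal.span {B | ∃ u v : σ →₀ ℕ, aDegree a u = aDegree a v ∧
    B = monomial u (1 : K) - monomial v (1 : K)}

/-- A binomial is a polynomial with exactly two terms. -/
def IsBinomial {K : Type*} [Field K] (B : MvPolynomial σ K) : Prop :=
  B.support.card = 2

/-- `S` is a minimal system of binomial generators of the ideal `I`: it consists of binomials,
generates `I`, and no proper subset of it generates `I`. -/
def IsMinimalBinomialGenerators {K : Type*} [Field K] (I : Ideal (MvPolynomial σ K))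
    (S : Set (MvPolynomial σ K)) : Prop :=
  (∀ B ∈ S, IsBinomial B) ∧ Ideal.span S = I ∧ ∀ T : Set (MvPolynomial σ K), T ⊂ S →
    Ideal.span T ≠ I

/-- A binomial `B` of the ideal `I` is indispensable if every minimal system of binomial
generators of `I` contains a nonzero constant multiple of `B`. -/
def IsIndispensable {K : Type*} [Field K] (I : Ideal (MvPolynomial σ K))
    (B : MvPolynomial σ K) : Prop :=
  B ∈ I ∧ IsBinomial B ∧ ∀ S : Set (MvPolynomial σ K), IsMinimalBinomialGenerators I S →
    ∃ c : K, c ≠ 0 ∧ C c * B ∈ S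

end Toric

/-! ### Blocks of a graph -/

section Blocks

variable {V : Type*} {G : SimpleGraph V}

/-- A biconnected graph: it is connected and has no cut vertex, i.e. the removal of a vertex
never disconnects it. -/
def IsBiconnected (H : G.Subgraph) : Prop :=
  H.Connected ∧ ∀ v ∈ H.verts, (H.deleteVerts {v}).Preconnected

/-- `B` is a block of `H`: a maximal biconnected subgraph of `H`. -/
def IsBlock (H B : G.Subgraph) : Prop :=
  Maximal (fun B' : G.Subgraph => B' ≤ H ∧ IsBiconnected B') B

/-- The subgraph `B` is a cycle. -/
def IsCycleGraph (B : G.Subgraph) : Prop :=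
  ∃ (x : V) (c : G.Walk x x), c.IsCycle ∧ c.toSubgraph = B

end Blocks

/-! ### The toric ideal of a graph and the binomial of an even closed walk -/

section Walks

variable {V : Type*} {G : SimpleGraph V}

/-- The vector `a_e = x + y` of the edge `e = {x, y}`, in the free abelian group on the
vertices. -/
def edgeVector (e : G.edgeSet) : V →₀ ℤ :=
  Sym2.lift ⟨fun x y => Finsupp.single x 1 + Finsupp.single y 1, fun _ _ => add_comm _ _⟩
    (e : Sym2 V)

/-- The toric ideal `I_G`, in the polynomial ring whose variables are the edges of `G`. -/
def graphIdeal (K : Type*) [Field K] (G : SimpleGraph V) : Ideal (MvPolynomial G.edgeSet K) :=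
  toricIdeal K (edgeVector (G := G))

/-- The `i`-th edge of the walk `w`, where `i = 0, 1, …, w.length - 1`. -/
def edgeAt {x y : V} (w : G.Walk x y) (i : Fin w.length) : G.edgeSet :=
  ⟨s(w.getVert i, w.getVert (i + 1)), w.adj_getVert_succ i.isLt⟩

/-- The exponent vector of `E⁺(w)`, the product of the first, third, fifth, … edge of `w`.
As indices start at `0` here, these edges have even index. -/
def expPlus {x y : V} (w : G.Walk x y) : G.edgeSet →₀ ℕ :=
  ∑ i : Fin w.length, if Even (i : ℕ) then Finsupp.single (edgeAt w i) 1 else 0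

/-- The exponent vector of `E⁻(w)`, the product of the second, fourth, sixth, … edge of `w`. -/
def expMinus {x y : V} (w : G.Walk x y) : G.edgeSet →₀ ℕ :=
  ∑ i : Fin w.length, if Odd (i : ℕ) then Finsupp.single (edgeAt w i) 1 else 0

/-- The binomial `B_w = E⁺(w) - E⁻(w)`. -/
def walkBinomial (K : Type*) [Field K] {x y : V} (w : G.Walk x y) : MvPolynomial G.edgeSet K :=
  monomial (expPlus w) (1 : K) - monomial (expMinus w) (1 : K)

/-- An even closed walk `w` is primitive if there is no (nonempty) even closed walk `ξ` of smaller
length such that `E⁺(ξ) ∣ E⁺(w)` and `E⁻(ξ) ∣ E⁻(w)`. The divisibility of the monomials is the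
componentwise order of their exponent vectors; it implies that `ξ` is a subwalk of `w`, i.e. that
the product of the edges of `ξ` divides the product of the edges of `w`. -/
def IsPrimitive {x : V} (w : G.Walk x x) : Prop :=
  ¬ ∃ (y : V) (ξ : G.Walk y y), Even ξ.length ∧ 0 < ξ.length ∧ ξ.length < w.length ∧
    expPlus ξ ≤ expPlus w ∧ expMinus ξ ≤ expMinus w

/-- `v` is a sink of the subgraph `B` (a block of the graph of `w`): it is a common vertex of two
odd or two even edges of the walk `w` which belong to `B`. Edges are taken with their
multiplicity in the walk. -/
def IsSink {x : V} (w : G.Walk x x) (B : G.Subgraph) (v : V) : Prop :=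
  ∃ i j : Fin w.length, i ≠ j ∧ (Even (i : ℕ) ↔ Even (j : ℕ)) ∧
    (edgeAt w i : Sym2 V) ∈ B.edgeSet ∧ (edgeAt w j : Sym2 V) ∈ B.edgeSet ∧
    v ∈ (edgeAt w i : Sym2 V) ∧ v ∈ (edgeAt w j : Sym2 V)

/-- A strongly primitive walk: a primitive walk without two sinks of a cyclic block at distance one
in that block. -/
def IsStronglyPrimitive {x : V} (w : G.Walk x x) : Prop :=
  IsPrimitive w ∧ ∀ B : G.Subgraph, IsBlock w.toSubgraph B → IsCycleGraph B →
    ∀ a b : V, IsSink w B a → IsSink w B b → ¬ B.Adj a b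

/-- A chord of `w`: an edge of `G` that joins two vertices of `w` and is not an edge of `w`. -/
def IsChord {x : V} (w : G.Walk x x) (f : Sym2 V) : Prop :=
  f ∈ G.edgeSet ∧ (∀ v ∈ f, v ∈ w.support) ∧ f ∉ w.edges

/-- A bridge of `w`: a chord whose two vertices lie one in each of two different blocks of the
graph of `w`. -/
def IsWalkBridge {x : V} (w : G.Walk x x) (f : Sym2 V) : Prop :=
  IsChord w f ∧ ∃ B₁ B₂ : G.Subgraph, IsBlock w.toSubgraph B₁ ∧ IsBlock w.toSubgraph B₂ ∧
    B₁ ≠ B₂ ∧ ∃ a ∈ B₁.verts, ∃ b ∈ B₂.verts, f = s(a, b)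

/-- With the vertices of the closed walk `w` numbered `0, 1, …, w.length - 1` along the walk, `f` is
an odd chord that joins the vertices with the numbers `s < j`: it is a chord, not a bridge, and
breaks the even closed walk `w` in two odd walks, of the lengths `j - s + 1` and
`w.length - (j - s) + 1`. -/
def IsOddChordAt {x : V} (w : G.Walk x x) (f : Sym2 V) (s j : ℕ) : Prop :=
  IsChord w f ∧ ¬ IsWalkBridge w f ∧ s < j ∧ j < w.length ∧
    f = s(w.getVert s, w.getVert j) ∧ Odd (j - s + 1)

/-- An odd chord of `w`. -/
def IsOddChord {x : V} (w : G.Walk x x) (f : Sym2 V) : Prop :=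
  ∃ s j : ℕ, IsOddChordAt w f s j

/-- Two odd chords `f = {v_s, v_j}` and `f' = {v_s', v_j'}` of `w`, `s < j` and `s' < j'`, cross
effectively if `s' - s` is odd and `s < s' < j < j'` or `s' < s < j' < j`. -/
def CrossEffectively {x : V} (w : G.Walk x x) (f f' : Sym2 V) : Prop :=
  ∃ s j s' j' : ℕ, IsOddChordAt w f s j ∧ IsOddChordAt w f' s' j' ∧
    Odd ((s' : ℤ) - (s : ℤ)) ∧ ((s < s' ∧ s' < j ∧ j < j') ∨ (s' < s ∧ s < j' ∧ j' < j))

end Walks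

end GraphToric

end

noncomputable section

namespace GraphToric

/-! ### Indispensable binomials and fibers -/

section Toric

variable {σ : Type*} {M : Type*} [AddCommMonoid M] {K : Type*} [Field K]

/-! Indispensability is a property of a single fiber: `B_w` is indispensable exactly when `E⁺` and
`E⁻` are coprime and are the only monomials of their degree (`isIndispensable_iff`, `IsTwoFiber`).
What remains is combinatorics, independent of the field. The walk is read as a periodic sequence of
vertices (`EvenCircuit`), and the conditions on blocks, sinks, bridges and chords become conditions
on indices (`IsCactus`, `IsRigid`). A coincidence below is a pair of indices of one period with the
same vertex.

From the fiber to the conditions: the alternating degree of an interval of indices telescopes to its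
two ends (`altDegree_Ico`). A forbidden configuration of coincidences and chords yields one
interval, or two, whose alternating degree is up to sign the degree of a few extra edges. Exchanging
the even edges of that set for its odd edges and the extra ones, or conversely, gives a new monomial
of the fiber (`exchange_plus`, `exchange_minus`). When there are no extra edges, the set contains a
shorter even closed walk (`exists_closed_walk`), so primitivity already forces coincidences to have
odd gaps and not to cross (`IsPrimitive.isCactus`).

From the conditions to the fiber: let `c` be a monomial of the fiber of a rigid circuit. Counting
degrees inside a coincidence modulo 2 (`even_inner`) shows that at a vertex visited twice `c` uses
either the inner pair of edges or the outer pair. So `c` behaves like a perfect matching of the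
indices by edges of the walk and chords (`exactly_one`). An alternating sum over the arc cut off by
a chord of `c` finds on that arc another chord end of the wrong parity; its chord is either shorter
or crosses effectively, so by induction `c` has no chord (`no_chord`). Then the edges of the walk
alternate between being in `c` and not, the multiplicities are forced, and `c` is `E⁺` or `E⁻`.

The translation to blocks rests on one fact: a coincidence is a cut vertex between the indices
inside and outside of it (`IsCactus.one_side`). Conversely, an edge traversed once lies in a cyclic
block formed by the edges that no coincidence separates from it (`exists_cyclic_block`). -/

theorem aDegree_add (a : σ → M) (u v : σ →₀ ℕ) : aDegree a (u + v) = aDegree a u + aDegree a v := by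
  classical
  exact Finsupp.sum_add_index (by simp) (by intros; rw [add_smul])

theorem aDegree_single (a : σ → M) (i : σ) (n : ℕ) : aDegree a (Finsupp.single i n) = n • a i := by
  simp [aDegree]

/-- `aDegree` as an additive homomorphism. -/
def aDegreeHom (a : σ → M) : (σ →₀ ℕ) →+ M where
  toFun := aDegree a
  map_zero' := by simp [aDegree]
  map_add' := aDegree_add a

theorem aDegree_sum (a : σ → M) {ι : Type*} (s : Finset ι) (f : ι → σ →₀ ℕ) :
    aDegree a (∑ i ∈ s, f i) = ∑ i ∈ s, aDegree a (f i) :=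
  map_sum (aDegreeHom a) f s

/-- A linear functional that vanishes on the monomial multiples of the generators of an ideal
vanishes on the ideal. -/
theorem linear_eq_zero_of_mem_span (l : MvPolynomial σ K →ₗ[K] K) (S : Set (MvPolynomial σ K))
    (h : ∀ g ∈ S, ∀ m : σ →₀ ℕ, l (monomial m 1 * g) = 0) {p : MvPolynomial σ K}
    (hp : p ∈ Ideal.span S) : l p = 0 := by
  induction hp using Submodule.span_induction with
  | mem x hx => simpa using h x hx 0
  | zero => simp
  | add x y _ _ hx hy => rw [map_add, hx, hy, add_zero]
  | smul q x hx ih =>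
    clear ih
    have key : ∀ m : σ →₀ ℕ, l (monomial m 1 * x) = 0 := by
      induction hx using Submodule.span_induction with
      | mem x hx => exact h x hx
      | zero => simp
      | add x y _ _ hx hy => intro m; rw [mul_add, map_add, hx, hy, add_zero]
      | smul q x _ ih =>
        intro m
        rw [smul_eq_mul]
        induction q using MvPolynomial.induction_on' with
        | monomial u r =>
          have : (monomial m (1 : K) * (monomial u r * x)) = r • (monomial (m + u) 1 * x) := by
            rw [← mul_assoc, monomial_mul, one_mul, ← smul_mul_assoc, smul_monomial, smul_eq_mul,
              mul_one]
          rw [this, map_smul, ih, smul_zero]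
        | add p q hp hq => rw [add_mul, mul_add, map_add, hp, hq, add_zero]
    rw [smul_eq_mul]
    induction q using MvPolynomial.induction_on' with
    | monomial u r =>
      have : (monomial u r * x) = r • (monomial u 1 * x) := by
        rw [← smul_mul_assoc, smul_monomial, smul_eq_mul, mul_one]
      rw [this, map_smul, key, smul_zero]
    | add p q hp hq => rw [add_mul, map_add, hp, hq, add_zero]

open Classical in
/-- The sum of the coefficients of the monomials of degree `d`. -/
def degreeSum (K : Type*) [Field K] (a : σ → M) (d : M) : MvPolynomial σ K →ₗ[K] K :=
  (basisMonomials σ K).constr K fun u => if aDegree a u = d then 1 else 0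

open Classical in
theorem degreeSum_monomial (a : σ → M) (d : M) (u : σ →₀ ℕ) (r : K) :
    degreeSum K a d (monomial u r) = if aDegree a u = d then r else 0 := by
  have h : monomial u r = r • basisMonomials σ K u := by
    rw [coe_basisMonomials, smul_monomial, smul_eq_mul, mul_one]
  rw [h, map_smul, degreeSum, Module.Basis.constr_basis]
  simp

theorem degreeSum_eq_zero (a : σ → M) (d : M) {p : MvPolynomial σ K}
    (hp : p ∈ toricIdeal K a) : degreeSum K a d p = 0 := by
  refine linear_eq_zero_of_mem_span _ _ ?_ hp
  rintro _ ⟨u, v, huv, rfl⟩ m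
  rw [mul_sub, monomial_mul, monomial_mul, map_sub, degreeSum_monomial, degreeSum_monomial,
    aDegree_add, aDegree_add, huv, sub_self]

/-- An element of the toric ideal has coefficient sum zero in every degree. A single monomial cannot
cancel alone, so both have the same degree and opposite coefficients. -/
theorem exists_eq_of_isBinomial (a : σ → M) {g : MvPolynomial σ K} (hg : g ∈ toricIdeal K a)
    (hb : IsBinomial g) : ∃ (u v : σ →₀ ℕ) (r : K), u ≠ v ∧ r ≠ 0 ∧ aDegree a u = aDegree a v ∧
      g = C r * (monomial u 1 - monomial v 1) := by
  classical
  obtain ⟨u, v, huv, hs⟩ := Finset.card_eq_two.1 hb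
  have hg' : g = monomial u (coeff u g) + monomial v (coeff v g) := by
    conv_lhs => rw [← support_sum_monomial_coeff g, hs, Finset.sum_pair huv]
  have hu : coeff u g ≠ 0 := mem_support_iff.1 (by rw [hs]; simp)
  have h0 := degreeSum_eq_zero a (aDegree a u) hg
  rw [hg', map_add, degreeSum_monomial, degreeSum_monomial, if_pos rfl] at h0
  split_ifs at h0 with h
  · refine ⟨u, v, coeff u g, huv, hu, h.symm, ?_⟩
    conv_lhs => rw [hg']
    rw [mul_sub, C_mul_monomial, C_mul_monomial, mul_one, eq_neg_of_add_eq_zero_right h0, map_neg,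
      sub_eq_add_neg]
  · exact absurd (by simpa using h0) hu

theorem isBinomial_sub {u v : σ →₀ ℕ} (huv : u ≠ v) :
    IsBinomial (monomial u (1 : K) - monomial v 1) := by
  classical
  have : (monomial u (1 : K) - monomial v 1).support = {u, v} := by
    ext m
    simp only [mem_support_iff, coeff_sub, coeff_monomial, Finset.mem_insert,
      Finset.mem_singleton]
    by_cases h1 : u = m <;> by_cases h2 : v = m
    · exact absurd (h1.trans h2.symm) huv
    · simp [h1, h2]
    · simp [h1, h2]
    · simp [h1, h2, Ne.symm h1, Ne.symm h2]
  rw [IsBinomial, this, Finset.card_pair huv]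

/-- A generating set of binomials of an ideal of a Noetherian ring contains a minimal one. -/
theorem exists_isMinimalBinomialGenerators_subset [Finite σ] (S : Set (MvPolynomial σ K))
    (hS : ∀ B ∈ S, IsBinomial B) :
    ∃ T ⊆ S, IsMinimalBinomialGenerators (Ideal.span S) T := by
  classical
  obtain ⟨T₀, hT₀, hT₀'⟩ := (Submodule.fg_span_iff_fg_span_finset_subset S).1
    (IsNoetherian.noetherian (Ideal.span S))
  let P : Set (Finset (MvPolynomial σ K)) :=
    {T | (T : Set (MvPolynomial σ K)) ⊆ S ∧ Ideal.span (T : Set (MvPolynomial σ K)) = Ideal.span S}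
  obtain ⟨T, hT, hmin⟩ := exists_minimal_of_wellFoundedLT (fun T => T ∈ P)
    ⟨T₀, hT₀, hT₀'.symm⟩
  refine ⟨T, hT.1, fun B hB => hS B (hT.1 hB), hT.2, fun T' hT' h => ?_⟩
  have hfin : T'.Finite := T.finite_toSet.subset hT'.subset
  have hc : (hfin.toFinset : Set (MvPolynomial σ K)) = T' := hfin.coe_toFinset
  have := hmin (y := hfin.toFinset) ⟨by rw [hc]; exact hT'.subset.trans hT.1, by rw [hc]; exact h⟩
    (by rw [← Finset.coe_subset, hc]; exact hT'.subset)
  exact hT'.2 (by rw [← hc]; exact Finset.coe_subset.2 this)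

/-- A binomial of a toric ideal is indispensable if and only if its two monomials are coprime and
the only monomials of their degree. -/
theorem isIndispensable_iff [Finite σ] [IsCancelAdd M] (a : σ → M) {u v : σ →₀ ℕ}
    (huv : aDegree a u = aDegree a v) (hne : u ≠ v) :
    IsIndispensable (toricIdeal K a) (monomial u (1 : K) - monomial v 1) ↔
      (∀ c, aDegree a c = aDegree a u → c = u ∨ c = v) ∧ ∀ i, u i = 0 ∨ v i = 0 := by
  classical
  constructor
  · rintro ⟨-, -, h⟩
    by_contra hcon
    -- All pure differences in the ideal except `±B`. They still generate: `B` is recovered by a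
    -- detour through a third monomial of the fiber, or as a multiple of the binomial obtained by
    -- cancelling a common variable.
    let S : Set (MvPolynomial σ K) := {B | ∃ c d : σ →₀ ℕ, aDegree a c = aDegree a d ∧ c ≠ d ∧
      ¬ (c = u ∧ d = v) ∧ ¬ (c = v ∧ d = u) ∧ B = monomial c (1 : K) - monomial d 1}
    have hle : Ideal.span S ≤ toricIdeal K a := by
      refine Ideal.span_mono ?_
      rintro _ ⟨c, d, h1, -, -, -, rfl⟩
      exact ⟨c, d, h1, rfl⟩
    have hB : monomial u (1 : K) - monomial v 1 ∈ Ideal.span S := by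
      rw [not_and_or] at hcon
      push Not at hcon
      rcases hcon with ⟨c, hc, hcu, hcv⟩ | ⟨i, hi, hi'⟩
      · have h1 : monomial u (1 : K) - monomial c 1 ∈ Ideal.span S := by
          refine Ideal.subset_span ⟨u, c, hc.symm, hcu.symm, ?_, ?_, rfl⟩
          · exact fun h => hcv h.2
          · exact fun h => hcu h.2
        have h2 : monomial c (1 : K) - monomial v 1 ∈ Ideal.span S := by
          refine Ideal.subset_span ⟨c, v, hc.trans huv, hcv, ?_, ?_, rfl⟩
          · exact fun h => hcu h.1
          · exact fun h => hcv h.1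
        simpa using Ideal.add_mem _ h1 h2
      · obtain ⟨u', rfl⟩ : ∃ u', u = Finsupp.single i 1 + u' :=
          le_iff_exists_add.1 (Finsupp.single_le_iff.2 (Nat.one_le_iff_ne_zero.2 hi))
        obtain ⟨v', rfl⟩ : ∃ v', v = Finsupp.single i 1 + v' :=
          le_iff_exists_add.1 (Finsupp.single_le_iff.2 (Nat.one_le_iff_ne_zero.2 hi'))
        have hd : aDegree a u' = aDegree a v' := by
          rw [aDegree_add, aDegree_add] at huv
          exact add_left_cancel huv
        have h1 : monomial u' (1 : K) - monomial v' 1 ∈ Ideal.span S := by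
          refine Ideal.subset_span ⟨u', v', hd, ?_, ?_, ?_, rfl⟩
          · rintro rfl; exact hne rfl
          · rintro ⟨h, -⟩
            simpa using DFunLike.congr_fun h i
          · rintro ⟨h1, h2⟩
            have e1 := DFunLike.congr_fun h1 i
            have e2 := DFunLike.congr_fun h2 i
            simp at e1 e2
            omega
        have := Ideal.mul_mem_left _ (monomial (Finsupp.single i 1) (1 : K)) h1
        simpa [mul_sub, monomial_mul] using this
    have heq : Ideal.span S = toricIdeal K a := by
      refine le_antisymm hle (Ideal.span_le.2 ?_)
      rintro _ ⟨c, d, h1, rfl⟩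
      by_cases hcd : c = d
      · simp [hcd]
      by_cases hc1 : c = u ∧ d = v
      · rw [hc1.1, hc1.2]; exact hB
      by_cases hc2 : c = v ∧ d = u
      · rw [hc2.1, hc2.2, ← neg_sub]; exact neg_mem hB
      exact Ideal.subset_span ⟨c, d, h1, hcd, hc1, hc2, rfl⟩
    obtain ⟨T, hTS, hT⟩ := exists_isMinimalBinomialGenerators_subset S (by
      rintro _ ⟨c, d, -, hcd, -, -, rfl⟩
      exact isBinomial_sub hcd)
    rw [heq] at hT
    obtain ⟨r, hr, hrT⟩ := h T hT
    obtain ⟨c, d, -, hcd, h1, h2, he⟩ := hTS hrT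
    have hsupp : ∀ m, coeff m (C r * (monomial u (1 : K) - monomial v 1)) ≠ 0 ↔ m = u ∨ m = v := by
      intro m
      simp only [coeff_C_mul, coeff_sub, coeff_monomial, mul_ne_zero_iff, ne_eq, hr,
        not_false_eq_true, true_and]
      by_cases h1 : u = m <;> by_cases h2 : v = m
      · exact absurd (h1.trans h2.symm) hne
      · simp [h1, h2]
      · simp [h1, h2]
      · simp [h1, h2, Ne.symm h1, Ne.symm h2]
    have hc := (hsupp c).1 (by rw [he]; simp [coeff_monomial, hcd.symm])
    have hd := (hsupp d).1 (by rw [he]; simp [coeff_monomial, hcd])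
    rcases hc with rfl | rfl <;> rcases hd with rfl | rfl <;> tauto
  · rintro ⟨hfib, hdisj⟩
    refine ⟨Ideal.subset_span ⟨u, v, huv, rfl⟩, isBinomial_sub hne, fun S ⟨hbin, hspan, _⟩ => ?_⟩
    by_contra hcon
    push Not at hcon
    have hmem : monomial u (1 : K) - monomial v 1 ∈ Ideal.span S := by
      rw [hspan]
      exact Ideal.subset_span ⟨u, v, huv, rfl⟩
    -- The coefficient at `u` is 1 on `B`, yet it vanishes on every monomial multiple of a
    -- generator. If such a multiple contains `u`, its other monomial must be `v`, and coprimality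
    -- makes the multiplier 1; the generator would be a multiple of `B`.
    have h0 := linear_eq_zero_of_mem_span (lcoeff K u) S ?_ hmem
    · rw [lcoeff_apply, coeff_sub, coeff_monomial, coeff_monomial, if_pos rfl,
        if_neg hne.symm] at h0
      simp at h0
    have key : ∀ (m c d : σ →₀ ℕ) (r : K), c ≠ d → r ≠ 0 → aDegree a c = aDegree a d →
        C r * (monomial c 1 - monomial d 1) ∈ S → m + c ≠ u := by
      intro m c d r hcd hr hdeg hmemS hmc
      have hd := hfib (m + d) (by rw [aDegree_add, ← hdeg, ← aDegree_add, hmc])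
      rcases hd with hd | hd
      · exact hcd (add_left_cancel (hmc.trans hd.symm))
      · have hm : m = 0 := by
          ext i
          have e1 := DFunLike.congr_fun hmc i
          have e2 := DFunLike.congr_fun hd i
          have e3 := hdisj i
          simp only [Finsupp.add_apply, Finsupp.coe_zero, Pi.zero_apply] at *
          omega
        rw [hm, zero_add] at hmc hd
        subst hmc hd
        exact hcon r hr hmemS
    intro g hg m
    obtain ⟨c, d, r, hcd, hr, hdeg, rfl⟩ := exists_eq_of_isBinomial a
      (by rw [← hspan]; exact Ideal.subset_span hg) (hbin g hg)
    have h1 := key m c d r hcd hr hdeg hg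
    have h2 := key m d c (-r) hcd.symm (neg_ne_zero.2 hr) hdeg.symm (by
      rwa [map_neg, neg_mul, ← mul_neg, neg_sub])
    rw [lcoeff_apply, mul_left_comm, coeff_C_mul, mul_sub, monomial_mul, monomial_mul, coeff_sub,
      coeff_monomial, coeff_monomial, if_neg h1, if_neg h2, sub_self, mul_zero]

end Toric

/-! ### Alternating sums -/

/-- The sign `(-1) ^ i` of an integer `i`. -/
def sgn (i : ℤ) : ℤ := if Even i then 1 else -1

theorem sgn_of_even {i : ℤ} (h : Even i) : sgn i = 1 := if_pos h

theorem sgn_of_odd {i : ℤ} (h : Odd i) : sgn i = -1 := if_neg (Int.not_even_iff_odd.2 h)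

theorem sgn_add_one (i : ℤ) : sgn (i + 1) = -sgn i := by
  rcases Int.even_or_odd i with h | h
  · rw [sgn_of_even h, sgn_of_odd h.add_one]
  · rw [sgn_of_odd h, sgn_of_even h.add_one, neg_neg]

theorem sgn_mul_self (i : ℤ) : sgn i * sgn i = 1 := by
  rcases Int.even_or_odd i with h | h
  · simp [sgn_of_even h]
  · simp [sgn_of_odd h]

theorem sgn_eq_of_even_sub {i j : ℤ} (h : Even (j - i)) : sgn j = sgn i := by
  have := Int.even_sub.1 h
  unfold sgn
  simp only [this]

theorem sgn_eq_neg_of_odd_sub {i j : ℤ} (h : Odd (j - i)) : sgn j = -sgn i := by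
  rw [← sgn_add_one]
  exact sgn_eq_of_even_sub (by rw [← sub_sub]; exact h.sub_odd odd_one)

theorem sum_Ico_sub_succ {A : Type*} [AddCommGroup A] (f : ℤ → A) {s j : ℤ} (h : s ≤ j) :
    ∑ i ∈ Finset.Ico s j, (f i - f (i + 1)) = f s - f j := by
  induction j, h using Int.leInduction with
  | base => simp
  | succ j h ih =>
    have : Finset.Ico s (j + 1) = insert j (Finset.Ico s j) := by ext; simp; omega
    rw [this, Finset.sum_insert (by simp), ih]
    abel

theorem sum_Ico_periodic {A : Type*} [AddCommMonoid A] (f : ℤ → A) {n : ℤ} (hn : 0 < n)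
    (hf : ∀ i, f (i + n) = f i) (t t' : ℤ) :
    ∑ i ∈ Finset.Ico t (t + n), f i = ∑ i ∈ Finset.Ico t' (t' + n), f i := by
  have step : ∀ t, ∑ i ∈ Finset.Ico (t + 1) (t + 1 + n), f i =
      ∑ i ∈ Finset.Ico t (t + n), f i := by
    intro t
    have h1 : Finset.Ico t (t + n) = insert t (Finset.Ico (t + 1) (t + n)) := by
      ext; simp; omega
    have h2 : Finset.Ico (t + 1) (t + 1 + n) = insert (t + n) (Finset.Ico (t + 1) (t + n)) := by
      ext; simp; omega
    rw [h1, h2, Finset.sum_insert (by simp), Finset.sum_insert (by simp), hf]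
  have key : ∀ t, ∑ i ∈ Finset.Ico t (t + n), f i = ∑ i ∈ Finset.Ico 0 (0 + n), f i := by
    intro t
    induction t using Int.induction_on with
    | zero => rfl
    | succ k ih => rw [step, ih]
    | pred k ih => rw [← step, ← ih]; congr 2 <;> ring
  rw [key, key t']

/-! ### Even closed walks as periodic sequences -/

section Circuit

variable {V : Type*} {G : SimpleGraph V}

/-- An even closed walk of length `n`, as an `n`-periodic sequence of vertices. -/
structure EvenCircuit (G : SimpleGraph V) where
  /-- the length -/
  n : ℤ
  n_pos : 0 < n
  even_n : Even n
  /-- the sequence of vertices -/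
  v : ℤ → V
  v_add_n : ∀ i, v (i + n) = v i
  adj : ∀ i, G.Adj (v i) (v (i + 1))

namespace EvenCircuit

variable (E : EvenCircuit G)

/-- The `i`-th edge. -/
def ed (i : ℤ) : G.edgeSet := ⟨s(E.v i, E.v (i + 1)), G.mem_edgeSet.2 (E.adj i)⟩

theorem coe_ed (i : ℤ) : (E.ed i : Sym2 V) = s(E.v i, E.v (i + 1)) := rfl

theorem ne_succ (i : ℤ) : E.v i ≠ E.v (i + 1) := (E.adj i).ne

theorem v_add_mul_n (i q : ℤ) : E.v (i + q * E.n) = E.v i := by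
  induction q using Int.induction_on with
  | zero => simp
  | succ k ih => rw [add_mul, one_mul, ← add_assoc, E.v_add_n, ih]
  | pred k ih =>
    rw [← ih, ← E.v_add_n (i + (-↑k - 1) * E.n)]
    congr 1; ring

theorem ed_add_mul_n (i q : ℤ) : E.ed (i + q * E.n) = E.ed i := by
  apply Subtype.ext
  rw [coe_ed, coe_ed, E.v_add_mul_n, add_right_comm, E.v_add_mul_n]

theorem ed_add_n (i : ℤ) : E.ed (i + E.n) = E.ed i := by
  simpa using E.ed_add_mul_n i 1

theorem even_add_mul_n (i q : ℤ) : Even (i + q * E.n) ↔ Even i := by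
  have := E.even_n.mul_left q
  rw [Int.even_add]
  tauto

/-- Every index has a representative in a given period. -/
theorem exists_rep (t k : ℤ) : ∃ q, t ≤ k + q * E.n ∧ k + q * E.n < t + E.n := by
  refine ⟨-((k - t) / E.n), ?_⟩
  have h1 := Int.emod_nonneg (k - t) E.n_pos.ne'
  have h2 := Int.emod_lt_of_pos (k - t) E.n_pos
  have h3 := Int.mul_ediv_add_emod (k - t) E.n
  constructor <;> nlinarith

/-- The vertex with index `i` is visited only once. -/
def Single (i : ℤ) : Prop := ∀ k, i < k → k < i + E.n → E.v k ≠ E.v i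

variable {E} in
theorem Single.exists_eq {i k : ℤ} (h : E.Single i) (hk : E.v k = E.v i) :
    ∃ q, k = i + q * E.n := by
  obtain ⟨q, h1, h2⟩ := E.exists_rep i k
  rcases h1.eq_or_lt with h1 | h1
  · exact ⟨-q, by linarith⟩
  · exact absurd ((E.v_add_mul_n k q).trans hk) (h _ h1 h2)

theorem not_single_iff {i : ℤ} : ¬ E.Single i ↔ ∃ j, i < j ∧ j < i + E.n ∧ E.v i = E.v j := by
  simp only [Single]
  push Not
  exact ⟨fun ⟨j, h1, h2, h3⟩ => ⟨j, h1, h2, h3.symm⟩, fun ⟨j, h1, h2, h3⟩ => ⟨j, h1, h2, h3.symm⟩⟩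

/-- The product of the edges with index in `S`, as an exponent vector. -/
def part (S : Finset ℤ) : G.edgeSet →₀ ℕ := ∑ i ∈ S, Finsupp.single (E.ed i) 1

/-- The product of the edges with even index. -/
def plus : G.edgeSet →₀ ℕ := E.part ((Finset.Ico 0 E.n).filter Even)

/-- The product of the edges with odd index. -/
def minus : G.edgeSet →₀ ℕ := E.part ((Finset.Ico 0 E.n).filter Odd)

theorem part_union {S T : Finset ℤ} (h : Disjoint S T) :
    E.part (S ∪ T) = E.part S + E.part T := Finset.sum_union h

theorem part_mono {S T : Finset ℤ} (h : S ⊆ T) : E.part S ≤ E.part T := by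
  classical
  rw [← Finset.sdiff_union_of_subset h, E.part_union Finset.sdiff_disjoint]
  exact le_add_of_nonneg_left zero_le

theorem part_pos_iff {S : Finset ℤ} {e : G.edgeSet} : 0 < E.part S e ↔ ∃ i ∈ S, E.ed i = e := by
  classical
  rw [part, Finsupp.finsetSum_apply, Finset.sum_pos_iff]
  refine exists_congr fun i => and_congr_right fun _ => ?_
  rw [Finsupp.single_apply]
  split_ifs with h <;> simp [h]

theorem plus_eq (t : ℤ) : E.plus = E.part ((Finset.Ico t (t + E.n)).filter Even) := by
  rw [plus, part, part, Finset.sum_filter, Finset.sum_filter]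
  have := sum_Ico_periodic (fun i => if Even i then Finsupp.single (E.ed i) 1 else 0) E.n_pos
    (fun i => by
      have h := E.even_add_mul_n i 1
      rw [one_mul] at h
      simp only [h, E.ed_add_n]) 0 t
  rwa [zero_add] at this

theorem minus_eq (t : ℤ) : E.minus = E.part ((Finset.Ico t (t + E.n)).filter Odd) := by
  rw [minus, part, part, Finset.sum_filter, Finset.sum_filter]
  have := sum_Ico_periodic (fun i => if Odd i then Finsupp.single (E.ed i) 1 else 0) E.n_pos
    (fun i => by
      have h := E.even_add_mul_n i 1
      rw [one_mul] at h
      simp only [← Int.not_even_iff_odd, h, E.ed_add_n]) 0 t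
  rwa [zero_add] at this

theorem plus_pos_of_even {i : ℤ} (h : Even i) : 0 < E.plus (E.ed i) := by
  rw [E.plus_eq i, part_pos_iff]
  exact ⟨i, by simp [h, E.n_pos], rfl⟩

theorem minus_pos_of_odd {i : ℤ} (h : Odd i) : 0 < E.minus (E.ed i) := by
  rw [E.minus_eq i, part_pos_iff]
  exact ⟨i, by simp [h, E.n_pos], rfl⟩

theorem exists_of_plus_pos {e : G.edgeSet} (h : 0 < E.plus e) : ∃ i, Even i ∧ E.ed i = e := by
  obtain ⟨i, hi, rfl⟩ := E.part_pos_iff.1 h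
  exact ⟨i, (Finset.mem_filter.1 hi).2, rfl⟩

theorem exists_of_minus_pos {e : G.edgeSet} (h : 0 < E.minus e) : ∃ i, Odd i ∧ E.ed i = e := by
  obtain ⟨i, hi, rfl⟩ := E.part_pos_iff.1 h
  exact ⟨i, (Finset.mem_filter.1 hi).2, rfl⟩

/-! ### Degrees -/

theorem edgeVector_mk {x y : V} (h : s(x, y) ∈ G.edgeSet) :
    edgeVector (G := G) ⟨s(x, y), h⟩ = Finsupp.single x 1 + Finsupp.single y 1 := rfl

theorem aDegree_part (S : Finset ℤ) : aDegree (edgeVector (G := G)) (E.part S) =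
    ∑ i ∈ S, (Finsupp.single (E.v i) 1 + Finsupp.single (E.v (i + 1)) 1) := by
  rw [part, aDegree_sum]
  refine Finset.sum_congr rfl fun i _ => ?_
  rw [aDegree_single, one_smul, ed, edgeVector_mk]

/-- The degree of `∏ e_i ^ ((-1) ^ i)`, `i ∈ S`. -/
def altDegree (S : Finset ℤ) : V →₀ ℤ :=
  ∑ i ∈ S, sgn i • (Finsupp.single (E.v i) 1 + Finsupp.single (E.v (i + 1)) 1)

theorem altDegree_union {S T : Finset ℤ} (h : Disjoint S T) :
    E.altDegree (S ∪ T) = E.altDegree S + E.altDegree T := Finset.sum_union h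

theorem aDegree_sub_eq_altDegree (S : Finset ℤ) :
    aDegree (edgeVector (G := G)) (E.part (S.filter Even)) -
      aDegree edgeVector (E.part (S.filter Odd)) = E.altDegree S := by
  rw [aDegree_part, aDegree_part, altDegree, Finset.sum_filter, Finset.sum_filter,
    ← Finset.sum_sub_distrib]
  refine Finset.sum_congr rfl fun i _ => ?_
  rcases Int.even_or_odd i with h | h
  · rw [sgn_of_even h, if_pos h, if_neg (Int.not_odd_iff_even.2 h), sub_zero, one_smul]
  · rw [sgn_of_odd h, if_pos h, if_neg (Int.not_even_iff_odd.2 h), zero_sub, neg_one_smul]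

/-- Each interior index contributes its vertex twice with opposite signs. All exchange arguments
evaluate this on one interval or on a disjoint union of two. -/
theorem altDegree_Ico {s j : ℤ} (h : s ≤ j) : E.altDegree (Finset.Ico s j) =
    sgn s • Finsupp.single (E.v s) 1 - sgn j • Finsupp.single (E.v j) 1 := by
  rw [← sum_Ico_sub_succ (fun i => sgn i • Finsupp.single (E.v i) (1 : ℤ)) h, altDegree]
  refine Finset.sum_congr rfl fun i _ => ?_
  rw [sgn_add_one, smul_add, neg_smul, sub_neg_eq_add]

theorem aDegree_plus_eq_minus :
    aDegree (edgeVector (G := G)) E.plus = aDegree edgeVector E.minus := by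
  rw [← sub_eq_zero, plus, minus, E.aDegree_sub_eq_altDegree, E.altDegree_Ico E.n_pos.le,
    sgn_eq_of_even_sub (i := 0) (j := E.n) (by simpa using E.even_n),
    show E.v E.n = E.v 0 by rw [← E.v_add_n 0, zero_add], sub_self]

/-- `E⁺` and `E⁻` have equal degrees and their product has every index of a period twice, so the
claim holds after doubling; the free abelian group has no 2-torsion. -/
theorem aDegree_plus (t : ℤ) : aDegree (edgeVector (G := G)) E.plus =
    ∑ i ∈ Finset.Ico t (t + E.n), Finsupp.single (E.v i) 1 := by
  classical
  let δ : ℤ → V →₀ ℤ := fun i => Finsupp.single (E.v i) 1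
  have h2 : (2 : ℤ) • aDegree (edgeVector (G := G)) E.plus =
      (2 : ℤ) • ∑ i ∈ Finset.Ico t (t + E.n), δ i := by
    have hsum : E.plus + E.minus = E.part (Finset.Ico t (t + E.n)) := by
      rw [E.plus_eq t, E.minus_eq t, ← E.part_union]
      · congr 1
        ext i
        simp only [Finset.mem_union, Finset.mem_filter, ← and_or_left,
          and_iff_left (Int.even_or_odd i)]
      · rw [Finset.disjoint_filter]
        exact fun i _ h => Int.not_odd_iff_even.2 h
    have h3 : aDegree (edgeVector (G := G)) (E.plus + E.minus) =
        ∑ i ∈ Finset.Ico t (t + E.n), δ i + ∑ i ∈ Finset.Ico t (t + E.n), δ (i + 1) := by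
      rw [hsum, aDegree_part, Finset.sum_add_distrib]
    have h4 : ∑ i ∈ Finset.Ico t (t + E.n), δ (i + 1) = ∑ i ∈ Finset.Ico t (t + E.n), δ i := by
      have h := sum_Ico_sub_succ δ (show t ≤ t + E.n by linarith [E.n_pos])
      rw [Finset.sum_sub_distrib, show δ (t + E.n) = δ t by simp only [δ, E.v_add_n],
        sub_self, sub_eq_zero] at h
      exact h.symm
    rw [aDegree_add, ← E.aDegree_plus_eq_minus, h4] at h3
    rw [two_smul, two_smul, h3]
  exact smul_right_injective _ (two_ne_zero (α := ℤ)) h2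

/-! ### Weighted counts in a fiber -/

/-- The value at an edge of the linear extension of a weight of the vertices. -/
def edgeWeight (φ : V → ℤ) (e : G.edgeSet) : ℤ :=
  Sym2.lift ⟨fun x y => φ x + φ y, fun _ _ => add_comm _ _⟩ (e : Sym2 V)

theorem linearCombination_edgeVector (φ : V → ℤ) (e : G.edgeSet) :
    Finsupp.linearCombination ℤ φ (edgeVector e) = edgeWeight φ e := by
  obtain ⟨e, he⟩ := e
  induction e with
  | h x y => simp [edgeVector, edgeWeight]

-- Applying the linear functional `φ` to both degrees turns equality in the free abelian group into
-- a count. The weights used below are indicators of a vertex and of the inside of a coincidence.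
variable {E} in
theorem sum_mul_edgeWeight {c : G.edgeSet →₀ ℕ}
    (hc : aDegree edgeVector c = aDegree edgeVector E.plus) (φ : V → ℤ) (t : ℤ) :
    ∑ e ∈ c.support, (c e : ℤ) * edgeWeight φ e = ∑ i ∈ Finset.Ico t (t + E.n), φ (E.v i) := by
  have h := congrArg (Finsupp.linearCombination ℤ φ) hc
  rw [E.aDegree_plus t, map_sum, aDegree, Finsupp.sum, map_sum] at h
  simpa [linearCombination_edgeVector] using h

variable {E} in
open Classical in
/-- The degree of a fiber element at a vertex is the number of visits of the walk. -/
theorem sum_filter_mem {c : G.edgeSet →₀ ℕ}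
    (hc : aDegree edgeVector c = aDegree edgeVector E.plus) (p : V) (t : ℤ) :
    ∑ e ∈ c.support.filter (fun e : G.edgeSet => p ∈ (e : Sym2 V)), c e =
      ((Finset.Ico t (t + E.n)).filter fun i => E.v i = p).card := by
  have h := sum_mul_edgeWeight hc (fun q => if q = p then 1 else 0) t
  rw [Finset.sum_boole] at h
  rw [← Nat.cast_inj (R := ℤ)]
  push_cast
  rw [← h, Finset.sum_filter]
  refine Finset.sum_congr rfl fun e _ => ?_
  obtain ⟨e, he⟩ := e
  induction e with
  | h x y =>
    have hxy : x ≠ y := G.ne_of_adj he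
    simp only [edgeWeight, Sym2.lift_mk, Sym2.mem_iff]
    by_cases h1 : x = p
    · have h2 : ¬ y = p := fun h2 => hxy (h1.trans h2.symm)
      simp [h1, h2]
    · by_cases h2 : y = p
      · simp [h1, h2]
      · simp [h1, h2, Ne.symm h1, Ne.symm h2]

end EvenCircuit

end Circuit

namespace EvenCircuit

variable {V : Type*} {G : SimpleGraph V} {E : EvenCircuit G}

/-! ### Combinatorial conditions on a circuit -/

/-- The coincidences among the vertices of the circuit are noncrossing and have odd gaps. -/
structure IsCactus (E : EvenCircuit G) : Prop where
  two_lt : 2 < E.n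
  odd : ∀ s j, s < j → j < s + E.n → E.v s = E.v j → Odd (j - s)
  noncross : ∀ s s' j j', s < s' → s' < j → j < j' → j' < s + E.n → E.v s = E.v j →
    E.v s' ≠ E.v j'

/-- A chord of the circuit. -/
def IsChordEdge (E : EvenCircuit G) (e : G.edgeSet) : Prop :=
  (∀ i, e ≠ E.ed i) ∧ ∀ p ∈ (e : Sym2 V), ∃ i, E.v i = p

/-- The conditions on the indices of a circuit that characterize indispensability. -/
structure IsRigid (E : EvenCircuit G) : Prop extends IsCactus E where
  sink : ∀ s j, s < j → j < s + E.n → E.v s = E.v j → E.ed s ≠ E.ed (j - 1) → E.Single (s + 1)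
  chord_single : ∀ e s j, E.IsChordEdge e → (e : Sym2 V) = s(E.v s, E.v j) → E.Single s
  chord_even : ∀ e s j, E.IsChordEdge e → (e : Sym2 V) = s(E.v s, E.v j) → Even (j - s)
  chord_sep : ∀ e s j, E.IsChordEdge e → (e : Sym2 V) = s(E.v s, E.v j) →
    ∀ k l, k < s → s < l → l < j → j < k + E.n → E.v k ≠ E.v l
  chord_cross : ∀ e e' s j s' j', E.IsChordEdge e → (e : Sym2 V) = s(E.v s, E.v j) →
    E.IsChordEdge e' → (e' : Sym2 V) = s(E.v s', E.v j') →
    s < s' → s' < j → j < j' → j' < s + E.n → ¬ Odd (s' - s)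

theorem exists_mk_eq {e : G.edgeSet} {p : V} (hp : p ∈ (e : Sym2 V)) :
    ∃ q, (e : Sym2 V) = s(p, q) ∧ G.Adj p q := by
  obtain ⟨q, hq⟩ := Sym2.mem_iff_exists.1 hp
  exact ⟨q, hq, by rw [← SimpleGraph.mem_edgeSet, ← hq]; exact e.2⟩

theorem mem_ed_left (E : EvenCircuit G) (i : ℤ) : E.v i ∈ (E.ed i : Sym2 V) :=
  Sym2.mem_mk_left _ _

theorem mem_ed_right (E : EvenCircuit G) (i : ℤ) : E.v (i + 1) ∈ (E.ed i : Sym2 V) :=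
  Sym2.mem_mk_right _ _

theorem mem_ed_pred (E : EvenCircuit G) (i : ℤ) : E.v i ∈ (E.ed (i - 1) : Sym2 V) := by
  simpa using E.mem_ed_right (i - 1)

theorem mem_ed_iff {i : ℤ} {p : V} : p ∈ (E.ed i : Sym2 V) ↔ p = E.v i ∨ p = E.v (i + 1) :=
  Sym2.mem_iff

namespace IsCactus

/-- A vertex visited at `s` and `j` is visited at no other index of the period. -/
theorem ne_of_lt (h : E.IsCactus) {s j k : ℤ} (hsj : s < j) (hj : j < s + E.n)
    (hv : E.v s = E.v j) (hk : s < k) (hk' : k < s + E.n) (hkj : k ≠ j) : E.v k ≠ E.v s := by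
  intro hks
  have h1 := h.odd s j hsj hj hv
  have h2 := h.odd s k hk hk' hks.symm
  -- Three visits in one period would give three odd gaps, one of them the sum of the other two.
  rcases lt_or_gt_of_ne hkj with h3 | h3
  · have h4 := h.odd k j h3 (by omega) (hks.trans hv)
    rw [Int.odd_iff] at *
    omega
  · have h4 := h.odd j k h3 (by omega) (hv.symm.trans hks.symm)
    rw [Int.odd_iff] at *
    omega

/-- The vertices inside and outside of a coincidence are different. -/
theorem ne_of_inside (h : E.IsCactus) {s j k l : ℤ} (hv : E.v s = E.v j)
    (hk : s < k) (hk' : k < j) (hl : j < l) (hl' : l < s + E.n) : E.v k ≠ E.v l :=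
  h.noncross s k j l hk hk' hl hl' hv

theorem three_le (h : E.IsCactus) {s j : ℤ} (hsj : s < j) (hj : j < s + E.n)
    (hv : E.v s = E.v j) : s + 3 ≤ j := by
  have h1 := h.odd s j hsj hj hv
  rw [Int.odd_iff] at h1
  have h2 : j ≠ s + 1 := by
    rintro rfl
    exact E.ne_succ s hv
  omega

theorem le_three (h : E.IsCactus) {s j : ℤ} (hsj : s < j) (hj : j < s + E.n)
    (hv : E.v s = E.v j) : j + 3 ≤ s + E.n :=
  h.three_le (s := j) (j := s + E.n) hj (by omega) (by rw [E.v_add_n, hv])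

/-- Turning back at once would make a coincidence with the even gap 2. -/
theorem ed_pred_ne (h : E.IsCactus) (i : ℤ) : E.ed (i - 1) ≠ E.ed i := by
  intro he
  have he' := congrArg Subtype.val he
  rw [coe_ed, coe_ed, sub_add_cancel, Sym2.eq_swap, Sym2.congr_right] at he'
  have h1 := h.odd (i - 1) (i + 1) (by omega) (by have := h.two_lt; omega) he'
  rw [Int.odd_iff] at h1
  omega

/-- The two edges of the walk at a vertex that is visited once. -/
theorem _root_.GraphToric.EvenCircuit.Single.eq_of_mem_ed {i k : ℤ} (hi : E.Single i)
    (hk : E.v i ∈ (E.ed k : Sym2 V)) : E.ed k = E.ed (i - 1) ∨ E.ed k = E.ed i := by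
  rcases mem_ed_iff.1 hk with hk | hk
  · obtain ⟨q, rfl⟩ := hi.exists_eq hk.symm
    exact Or.inr (E.ed_add_mul_n i q)
  · obtain ⟨q, hq⟩ := hi.exists_eq hk.symm
    left
    rw [← E.ed_add_mul_n (i - 1) q]
    congr 1
    linarith

/-- The four edges of the walk at a vertex that is visited twice. -/
theorem mem_of_mem_ed (h : E.IsCactus) {s j k : ℤ} (hsj : s < j) (hj : j < s + E.n)
    (hv : E.v s = E.v j) (hk : E.v s ∈ (E.ed k : Sym2 V)) :
    E.ed k = E.ed s ∨ E.ed k = E.ed (j - 1) ∨ E.ed k = E.ed j ∨ E.ed k = E.ed (s - 1) := by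
  have aux : ∀ m, E.v m = E.v s → ∃ q, m = s + q * E.n ∨ m = j + q * E.n := by
    intro m hm
    obtain ⟨q, h1, h2⟩ := E.exists_rep s m
    by_contra hcon
    push Not at hcon
    refine h.ne_of_lt (k := m + q * E.n) hsj hj hv (lt_of_le_of_ne h1 ?_) h2 ?_
      ((E.v_add_mul_n m q).trans hm)
    · intro h3
      exact (hcon (-q)).1 (by linarith)
    · intro h3
      exact (hcon (-q)).2 (by linarith)
  rcases mem_ed_iff.1 hk with hk | hk
  · obtain ⟨q, rfl | rfl⟩ := aux k hk.symm
    · exact Or.inl (E.ed_add_mul_n s q)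
    · exact Or.inr (Or.inr (Or.inl (E.ed_add_mul_n j q)))
  · obtain ⟨q, hq | hq⟩ := aux (k + 1) hk.symm
    · right; right; right
      rw [← E.ed_add_mul_n (s - 1) q]
      congr 1; linarith
    · right; left
      rw [← E.ed_add_mul_n (j - 1) q]
      congr 1; linarith

end IsCactus

/-- The vertices strictly between the indices `s` and `j`. -/
def inside (E : EvenCircuit G) (s j : ℤ) : Set V := {p | ∃ k, s < k ∧ k < j ∧ E.v k = p}

theorem IsCactus.mem_inside_iff (h : E.IsCactus) {s j : ℤ} (hsj : s < j) (hj : j < s + E.n)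
    (hv : E.v s = E.v j) {k : ℤ} (h1 : s ≤ k) (h2 : k ≤ s + E.n) :
    E.v k ∈ E.inside s j ↔ s < k ∧ k < j := by
  refine ⟨?_, fun h3 => ⟨k, h3.1, h3.2, rfl⟩⟩
  rintro ⟨l, h3, h4, h5⟩
  have h6 : E.v l ≠ E.v s := h.ne_of_lt hsj hj hv h3 (by omega) (by omega)
  by_contra hcon
  rcases (by omega : k = s ∨ k = j ∨ k = s + E.n ∨ (j < k ∧ k < s + E.n)) with
    rfl | rfl | rfl | h7
  · exact h6 h5
  · exact h6 (h5.trans hv.symm)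
  · exact h6 (h5.trans (E.v_add_n s))
  · exact h.ne_of_inside hv h3 h4 h7.1 h7.2 h5

/-! ### Elements of the fiber -/

section Fiber

variable {c : G.edgeSet →₀ ℕ}

theorem exists_index_of_pos (hc : aDegree edgeVector c = aDegree edgeVector E.plus)
    {e : G.edgeSet} (he : 0 < c e) {p : V} (hp : p ∈ (e : Sym2 V)) : ∃ i, E.v i = p := by
  classical
  have h := sum_filter_mem hc p 0
  have hpos : 0 < ∑ e ∈ c.support.filter (fun e : G.edgeSet => p ∈ (e : Sym2 V)), c e :=
    Finset.sum_pos' (fun _ _ => zero_le) ⟨e, by simp [hp, he.ne'], he⟩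
  rw [h, Finset.card_pos] at hpos
  obtain ⟨i, hi⟩ := hpos
  exact ⟨i, (Finset.mem_filter.1 hi).2⟩

theorem isChordEdge_of_pos (hc : aDegree edgeVector c = aDegree edgeVector E.plus)
    {e : G.edgeSet} (he : 0 < c e) (hne : ∀ i, e ≠ E.ed i) : E.IsChordEdge e :=
  ⟨hne, fun _ hp => exists_index_of_pos hc he hp⟩

open Classical in
theorem sum_filter_mem_single (hc : aDegree edgeVector c = aDegree edgeVector E.plus) {i : ℤ}
    (hi : E.Single i) :
    ∑ e ∈ c.support.filter (fun e : G.edgeSet => E.v i ∈ (e : Sym2 V)), c e = 1 := by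
  rw [sum_filter_mem hc (E.v i) i, Finset.card_eq_one]
  refine ⟨i, ?_⟩
  ext k
  simp only [Finset.mem_filter, Finset.mem_Ico, Finset.mem_singleton]
  constructor
  · rintro ⟨⟨h1, h2⟩, h3⟩
    by_contra h4
    exact hi k (by omega) h2 h3
  · rintro rfl
    have := E.n_pos
    exact ⟨⟨le_rfl, by omega⟩, rfl⟩

theorem eq_one_of_single (hc : aDegree edgeVector c = aDegree edgeVector E.plus) {i : ℤ}
    (hi : E.Single i) {e : G.edgeSet} (he : 0 < c e) (hm : E.v i ∈ (e : Sym2 V)) : c e = 1 := by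
  classical
  have h := sum_filter_mem_single hc hi
  have := Finset.single_le_sum (f := c) (fun _ _ => Nat.zero_le _)
    (show e ∈ c.support.filter (fun e : G.edgeSet => E.v i ∈ (e : Sym2 V)) by simp [hm, he.ne'])
  omega

theorem eq_of_single (hc : aDegree edgeVector c = aDegree edgeVector E.plus) {i : ℤ}
    (hi : E.Single i) {e e' : G.edgeSet} (he : 0 < c e) (hm : E.v i ∈ (e : Sym2 V))
    (he' : 0 < c e') (hm' : E.v i ∈ (e' : Sym2 V)) : e = e' := by
  classical
  by_contra hne
  have h := sum_filter_mem_single hc hi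
  have := Finset.sum_le_sum_of_subset (f := c)
    (show ({e, e'} : Finset G.edgeSet) ⊆
      c.support.filter (fun e : G.edgeSet => E.v i ∈ (e : Sym2 V)) by
        intro x hx
        rcases Finset.mem_insert.1 hx with rfl | hx
        · simp [hm, he.ne']
        · rw [Finset.mem_singleton.1 hx]
          simp [hm', he'.ne'])
  rw [Finset.sum_pair hne] at this
  omega

theorem exists_of_single (hc : aDegree edgeVector c = aDegree edgeVector E.plus) {i : ℤ}
    (hi : E.Single i) : ∃ e : G.edgeSet, 0 < c e ∧ E.v i ∈ (e : Sym2 V) := by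
  classical
  have h := sum_filter_mem_single hc hi
  by_contra hcon
  push Not at hcon
  rw [Finset.sum_eq_zero] at h
  · simp at h
  · intro e he
    rw [Finset.mem_filter, Finsupp.mem_support_iff] at he
    exact absurd he.2 (hcon e (Nat.pos_of_ne_zero he.1))

/-! ### Parity at a vertex visited twice -/

open Classical in
/-- The multiplicity in `c` of the two edges inside a coincidence at its vertex. -/
def inner (E : EvenCircuit G) (c : G.edgeSet →₀ ℕ) (s j : ℤ) : ℕ :=
  ∑ e ∈ ({E.ed s, E.ed (j - 1)} : Finset G.edgeSet), c e

/-- Weight each vertex by membership in the inside of the coincidence. The total weight of `c` is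
the number `j - s - 1` of inner indices, which is even. Modulo 2 only edges with exactly one end
inside count. Chords never have exactly one end inside, so these are `E.ed s` and `E.ed (j - 1)`,
counted once if they are the same edge. -/
theorem even_inner (h : E.IsRigid) (hc : aDegree edgeVector c = aDegree edgeVector E.plus)
    {s j : ℤ} (hsj : s < j) (hj : j < s + E.n) (hv : E.v s = E.v j) :
    Even (E.inner c s j) := by
  classical
  obtain ⟨X, hXdef⟩ : ∃ X, X = E.inside s j := ⟨_, rfl⟩
  have hX : ∀ k, s ≤ k → k ≤ s + E.n → (E.v k ∈ X ↔ s < k ∧ k < j) := fun k h1 h2 => by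
    rw [hXdef]
    exact h.mem_inside_iff hsj hj hv h1 h2
  have hid := sum_mul_edgeWeight hc (fun q => if q ∈ X then 1 else 0) s
  rw [Finset.sum_boole] at hid
  have hcard : ((Finset.Ico s (s + E.n)).filter fun i => E.v i ∈ X) = Finset.Ico (s + 1) j := by
    ext k
    simp only [Finset.mem_filter, Finset.mem_Ico]
    constructor
    · rintro ⟨⟨h1, h2⟩, h3⟩
      have := (hX k h1 h2.le).1 h3
      omega
    · rintro ⟨h1, h2⟩
      exact ⟨by omega, (hX k (by omega) (by omega)).2 (by omega)⟩
  rw [hcard, Int.card_Ico] at hid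
  have hpar : Even (∑ e ∈ c.support, ((c e : ℤ) * edgeWeight (fun q => if q ∈ X then 1 else 0) e -
      if e ∈ ({E.ed s, E.ed (j - 1)} : Finset G.edgeSet) then (c e : ℤ) else 0)) := by
    refine Finset.even_sum _ fun e he => ?_
    have hpos : 0 < c e := Nat.pos_of_ne_zero (Finsupp.mem_support_iff.1 he)
    by_cases hw : ∃ i, e = E.ed i
    · obtain ⟨i, hi⟩ := hw
      obtain ⟨q, h1, h2⟩ := E.exists_rep s i
      obtain ⟨k, hk⟩ : ∃ k, k = i + q * E.n := ⟨_, rfl⟩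
      have hek : e = E.ed k := by rw [hi, hk, E.ed_add_mul_n]
      rw [← hk] at h1 h2
      subst hek
      have e1 := hX k h1 h2.le
      have e2 := hX (k + 1) (by omega) (by omega)
      have hwt : edgeWeight (fun q => if q ∈ X then 1 else 0) (E.ed k) =
          (if s < k ∧ k < j then 1 else 0) + (if s < k + 1 ∧ k + 1 < j then 1 else 0) := by
        simp only [edgeWeight, ed, Sym2.lift_mk, e1, e2]
      rw [hwt]
      have h3j := h.three_le hsj hj hv
      have hmem : E.ed k ∈ ({E.ed s, E.ed (j - 1)} : Finset G.edgeSet) ↔ k = s ∨ k = j - 1 := by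
        rw [Finset.mem_insert, Finset.mem_singleton]
        refine ⟨fun hk => ?_, fun hk => hk.imp (congrArg _) (congrArg _)⟩
        by_contra hcon
        -- one end of `E.ed s` and `E.ed (j - 1)` is in `X`, the other is not
        have hxor : (s < k ∧ k < j ∧ ¬ (k + 1 < j)) ∨ (k = s) := by
          have key : (E.v k ∈ X ∧ ¬ E.v (k + 1) ∈ X) ∨ (¬ E.v k ∈ X ∧ E.v (k + 1) ∈ X) := by
            have a1 : ¬ E.v s ∈ X := by
              rw [hX s le_rfl (by omega)]; omega
            have a2 : E.v (s + 1) ∈ X := (hX _ (by omega) (by omega)).2 (by omega)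
            have a3 : E.v (j - 1) ∈ X := (hX _ (by omega) (by omega)).2 (by omega)
            have a4 : ¬ E.v (j - 1 + 1) ∈ X := by
              rw [sub_add_cancel, ← hv]; exact a1
            rcases hk with hk | hk <;> have hk' := congrArg Subtype.val hk <;>
              rw [coe_ed, coe_ed, Sym2.eq_iff] at hk' <;>
              rcases hk' with ⟨b1, b2⟩ | ⟨b1, b2⟩ <;> rw [b1, b2] <;> tauto
          rw [e1, e2] at key
          omega
        omega
      simp only [hmem]
      by_cases c1 : k = s
      · rw [if_neg (by omega), if_pos (by omega), if_pos (Or.inl c1)]; simp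
      by_cases c2 : k = j - 1
      · rw [if_pos (by omega), if_neg (by omega), if_pos (Or.inr c2)]; simp
      rw [if_neg (show ¬ (k = s ∨ k = j - 1) by tauto), sub_zero]
      refine Even.mul_left ?_ _
      by_cases c3 : s < k ∧ k < j
      · rw [if_pos c3, if_pos (by omega)]; decide
      · rw [if_neg c3, if_neg (by omega)]; decide
    · push Not at hw
      have hch := isChordEdge_of_pos hc hpos hw
      rw [if_neg, sub_zero]
      · refine Even.mul_left ?_ _
        obtain ⟨⟨x, y⟩, hxy⟩ := Quot.exists_rep (e : Sym2 V)
        have hxy' : (e : Sym2 V) = s(x, y) := hxy.symm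
        obtain ⟨a, rfl⟩ := hch.2 x (by rw [hxy']; exact Sym2.mem_mk_left _ _)
        obtain ⟨b, rfl⟩ := hch.2 y (by rw [hxy']; exact Sym2.mem_mk_right _ _)
        -- A chord with ends on different sides would have both ends visited once and separated by
        -- the coincidence, contrary to `chord_sep`.
        have hside : E.v a ∈ X ↔ E.v b ∈ X := by
          have main : ∀ a b, (e : Sym2 V) = s(E.v a, E.v b) → E.v a ∈ X → E.v b ∈ X := by
            rw [hXdef]
            rintro a b hab ⟨k, h1, h2, h3⟩
            obtain ⟨q, h4, h5⟩ := E.exists_rep s b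
            rw [← E.v_add_mul_n b q]
            by_contra hcon
            rw [h.mem_inside_iff hsj hj hv h4 h5.le] at hcon
            have hsb : E.Single (b + q * E.n) := by
              refine h.chord_single e (b + q * E.n) a hch ?_
              rw [hab, E.v_add_mul_n, Sym2.eq_swap]
            have hnes : b + q * E.n ≠ s := by
              intro h6
              rw [h6] at hsb
              exact hsb j hsj hj hv.symm
            have hnej : b + q * E.n ≠ j := by
              intro h6
              rw [h6] at hsb
              exact hsb (s + E.n) hj (by omega) (by rw [E.v_add_n, hv])
            refine h.chord_sep e k (b + q * E.n) hch ?_ s j h1 h2 (by omega) (by omega) hv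
            rw [hab, h3, E.v_add_mul_n]
          exact ⟨main a b hxy', main b a (by rw [hxy', Sym2.eq_swap])⟩
        simp only [edgeWeight, hxy', Sym2.lift_mk, hside]
        split_ifs <;> decide
      · rw [Finset.mem_insert, Finset.mem_singleton]
        rintro (h1 | h1)
        · exact hw _ h1
        · exact hw _ h1
  rw [Finset.sum_sub_distrib, hid, Finset.sum_ite_mem] at hpar
  have hinter : ∑ e ∈ c.support ∩ {E.ed s, E.ed (j - 1)}, (c e : ℤ) = E.inner c s j := by
    rw [inner]
    push_cast
    refine Finset.sum_subset Finset.inter_subset_right fun e h1 h2 => ?_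
    have : c e = 0 := by
      by_contra h3
      exact h2 (Finset.mem_inter.2 ⟨Finsupp.mem_support_iff.2 h3, h1⟩)
    rw [this, Nat.cast_zero]
  rw [hinter] at hpar
  have hodd := h.odd s j hsj hj hv
  rw [Int.odd_iff] at hodd
  rw [Int.even_iff] at hpar
  rw [Nat.even_iff]
  have : (((j - (s + 1)).toNat : ℕ) : ℤ) = j - (s + 1) := Int.toNat_of_nonneg (by omega)
  simp only [this] at hpar
  omega

theorem IsRigid.single_right (h : E.IsRigid) {e : G.edgeSet} {s j : ℤ} (he : E.IsChordEdge e)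
    (hsj : (e : Sym2 V) = s(E.v s, E.v j)) : E.Single j :=
  h.chord_single e j s he (by rw [hsj, Sym2.eq_swap])

/-- The mirror image of `sink`. If the vertex at `j - 1` recurs at `l`, then `sink` for that
coincidence makes the vertex at `j` single, which it is not. The exception `E.ed (j - 1) = E.ed (l -
1)` forces `l - 1 = s + n` and contradicts `hne`. -/
theorem IsRigid.sink_right (h : E.IsRigid) {s j : ℤ} (hsj : s < j) (hj : j < s + E.n)
    (hv : E.v s = E.v j) (hne : E.ed s ≠ E.ed (j - 1)) : E.Single (j - 1) := by
  by_contra hcon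
  obtain ⟨l, h1, h2, h3⟩ := not_single_iff E |>.1 hcon
  have h3j := h.three_le hsj hj hv
  by_cases he : E.ed (j - 1) = E.ed (l - 1)
  · have he' := congrArg Subtype.val he
    rw [coe_ed, coe_ed, sub_add_cancel, sub_add_cancel, h3, Sym2.eq_swap, Sym2.congr_left] at he'
    have hl : l - 1 = s + E.n := by
      by_contra hl
      have hlj : l - 1 ≠ j := by
        rintro hlj
        rw [show l = j + 1 by omega] at h3
        have := h.odd (j - 1) (j + 1) (by omega) (by omega) h3
        rw [Int.odd_iff] at this
        omega
      rcases lt_or_ge (l - 1) (s + E.n) with h5 | h5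
      · exact h.ne_of_lt (k := l - 1) hsj hj hv (by omega) h5 hlj (he'.symm.trans hv.symm)
      · refine h.ne_of_lt (k := l - 1 - E.n) hsj hj hv (by omega) (by omega) (by omega) ?_
        rw [← E.v_add_n (l - 1 - E.n), sub_add_cancel, ← he', hv]
    rw [he, hl, E.ed_add_n] at hne
    exact hne rfl
  · have := h.sink (j - 1) l h1 h2 h3 he
    rw [sub_add_cancel] at this
    exact this (s + E.n) hj (by omega) (by rw [E.v_add_n, hv])

theorem inner_of_ne {s j : ℤ} (hne : E.ed s ≠ E.ed (j - 1)) :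
    E.inner c s j = c (E.ed s) + c (E.ed (j - 1)) := by
  classical
  rw [inner, Finset.sum_pair hne]

theorem inner_of_eq {s j : ℤ} (he : E.ed s = E.ed (j - 1)) : E.inner c s j = c (E.ed s) := by
  classical
  rw [inner, ← he, Finset.pair_eq_singleton, Finset.sum_singleton]

/-- The vertex is visited twice, so `c` has degree 2 there, and no chord ends there. The inner and
outer edges are disjoint because an inner edge has an end strictly inside. With `even_inner` the two
multiplicities are 2 and 0 in some order. -/
theorem inner_add_inner (h : E.IsRigid) (hc : aDegree edgeVector c = aDegree edgeVector E.plus)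
    {s j : ℤ} (hsj : s < j) (hj : j < s + E.n) (hv : E.v s = E.v j) :
    E.inner c s j + E.inner c j (s + E.n) = 2 := by
  classical
  have h1 := sum_filter_mem hc (E.v s) s
  have h3 := h.three_le hsj hj hv
  have h3' := h.le_three hsj hj hv
  have hcard : ((Finset.Ico s (s + E.n)).filter fun i => E.v i = E.v s) = {s, j} := by
    ext k
    simp only [Finset.mem_filter, Finset.mem_Ico, Finset.mem_insert, Finset.mem_singleton]
    constructor
    · rintro ⟨⟨h4, h5⟩, h6⟩
      by_contra hcon
      exact h.ne_of_lt hsj hj hv (by omega) h5 (by tauto) h6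
    · rintro (rfl | rfl)
      · exact ⟨⟨le_rfl, by omega⟩, rfl⟩
      · exact ⟨⟨by omega, by omega⟩, hv.symm⟩
  rw [hcard, Finset.card_pair (by omega)] at h1
  rw [← h1, inner, inner, ← Finset.sum_union]
  · symm
    refine Finset.sum_subset ?_ ?_
    · intro e he
      rw [Finset.mem_filter, Finsupp.mem_support_iff] at he
      by_cases hw : ∃ k, e = E.ed k
      · obtain ⟨k, rfl⟩ := hw
        have := h.mem_of_mem_ed hsj hj hv he.2
        have h4 : E.ed (s + E.n - 1) = E.ed (s - 1) := by
          rw [← E.ed_add_n (s - 1)]; congr 1; ring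
        simp only [Finset.mem_union, Finset.mem_insert, Finset.mem_singleton, h4]
        tauto
      · push Not at hw
        have hch := isChordEdge_of_pos hc (Nat.pos_of_ne_zero he.1) hw
        obtain ⟨q, hq, -⟩ := exists_mk_eq he.2
        obtain ⟨b, rfl⟩ := hch.2 q (by rw [hq]; exact Sym2.mem_mk_right _ _)
        exact absurd hv.symm (h.chord_single e s b hch hq j hsj hj)
    · intro e he he'
      by_contra h0
      refine he' (Finset.mem_filter.2 ⟨Finsupp.mem_support_iff.2 h0, ?_⟩)
      simp only [Finset.mem_union, Finset.mem_insert, Finset.mem_singleton] at he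
      rcases he with (rfl | rfl) | (rfl | rfl)
      · exact E.mem_ed_left s
      · rw [hv]; exact E.mem_ed_pred j
      · rw [hv]; exact E.mem_ed_left j
      · rw [← E.v_add_n s]; exact E.mem_ed_pred _
  · have key : ∀ k l, E.ed k = E.ed l → (s < k ∧ k < j ∨ s < k + 1 ∧ k + 1 < j) → s ≤ k → k < j →
        j ≤ l → l < s + E.n → False := by
      intro k l hkl hk hk1 hk2 hl1 hl2
      have hx : ∀ x, s < x → x < j → E.v x ∉ (E.ed l : Sym2 V) := by
        intro x hx1 hx2 hx3
        have aux : ∀ y, j ≤ y → y ≤ s + E.n → E.v x ≠ E.v y := by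
          intro y hy1 hy2
          rcases hy1.eq_or_lt with rfl | hy1
          · rw [← hv]
            exact h.ne_of_lt hsj hj hv hx1 (by omega) (by omega)
          rcases hy2.eq_or_lt with rfl | hy2
          · rw [E.v_add_n]
            exact h.ne_of_lt hsj hj hv hx1 (by omega) (by omega)
          · exact h.ne_of_inside hv hx1 hx2 hy1 hy2
        rcases mem_ed_iff.1 hx3 with hx3 | hx3
        · exact aux l hl1 (by omega) hx3
        · exact aux (l + 1) (by omega) (by omega) hx3
      rcases hk with hk | hk
      · exact hx k hk.1 hk.2 (by rw [← hkl]; exact E.mem_ed_left k)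
      · exact hx (k + 1) hk.1 hk.2 (by rw [← hkl]; exact E.mem_ed_right k)
    rw [Finset.disjoint_left]
    intro e he he'
    simp only [Finset.mem_insert, Finset.mem_singleton] at he he'
    rcases he with rfl | rfl <;> rcases he' with he' | he'
    · exact key _ _ he' (by omega) (by omega) (by omega) (by omega) (by omega)
    · exact key _ _ he' (by omega) (by omega) (by omega) (by omega) (by omega)
    · exact key _ _ he' (by omega) (by omega) (by omega) (by omega) (by omega)
    · exact key _ _ he' (by omega) (by omega) (by omega) (by omega) (by omega)

/-- If the two inner edges differ, the sink condition makes their far ends single, so each has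
multiplicity at most 1; an even sum leaves both or neither. -/
theorem inner_pos_iff (h : E.IsRigid) (hc : aDegree edgeVector c = aDegree edgeVector E.plus)
    {s j : ℤ} (hsj : s < j) (hj : j < s + E.n) (hv : E.v s = E.v j) :
    (0 < E.inner c s j ↔ 0 < c (E.ed s)) ∧ (0 < E.inner c s j ↔ 0 < c (E.ed (j - 1))) := by
  by_cases he : E.ed s = E.ed (j - 1)
  · rw [inner_of_eq he, ← he]
    tauto
  · have h1 := h.sink s j hsj hj hv he
    have h2 := h.sink_right hsj hj hv he
    have h3 : c (E.ed s) ≤ 1 := by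
      by_contra h4
      have := eq_one_of_single hc h1 (e := E.ed s) (by omega) (E.mem_ed_right s)
      omega
    have h4 : c (E.ed (j - 1)) ≤ 1 := by
      by_contra h4
      have := eq_one_of_single hc h2 (e := E.ed (j - 1)) (by omega) (E.mem_ed_left _)
      omega
    have h5 := even_inner h hc hsj hj hv
    rw [inner_of_ne he, Nat.even_iff] at *
    omega

/-! ### Fiber elements as matchings of the indices -/

/-- `c` contains a chord at the vertex with index `i`. -/
def HasChordAt (E : EvenCircuit G) (c : G.edgeSet →₀ ℕ) (i : ℤ) : Prop :=
  ∃ e, 0 < c e ∧ E.v i ∈ (e : Sym2 V) ∧ ∀ k, e ≠ E.ed k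

theorem HasChordAt.exists_eq (hc : aDegree edgeVector c = aDegree edgeVector E.plus) {i : ℤ}
    (h : E.HasChordAt c i) : ∃ e j, 0 < c e ∧ E.IsChordEdge e ∧ (e : Sym2 V) = s(E.v i, E.v j) := by
  obtain ⟨e, h1, h2, h3⟩ := h
  obtain ⟨q, hq, -⟩ := exists_mk_eq h2
  have hch := isChordEdge_of_pos hc h1 h3
  obtain ⟨j, rfl⟩ := hch.2 q (by rw [hq]; exact Sym2.mem_mk_right _ _)
  exact ⟨e, j, h1, hch, hq⟩

open Classical in
/-- A fiber element induces a perfect matching of the indices. -/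
theorem exactly_one (h : E.IsRigid) (hc : aDegree edgeVector c = aDegree edgeVector E.plus)
    (i : ℤ) : ((if 0 < c (E.ed (i - 1)) then 1 else 0) + (if 0 < c (E.ed i) then 1 else 0) +
      (if E.HasChordAt c i then 1 else 0) : ℤ) = 1 := by
  by_cases hi : E.Single i
  · obtain ⟨e, he, hm⟩ := exists_of_single hc hi
    have huniq : ∀ e', 0 < c e' → E.v i ∈ (e' : Sym2 V) → e = e' := fun e' h1 h2 =>
      eq_of_single hc hi he hm h1 h2
    have h1 : 0 < c (E.ed (i - 1)) → e = E.ed (i - 1) := fun h1 => huniq _ h1 (E.mem_ed_pred i)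
    have h2 : 0 < c (E.ed i) → e = E.ed i := fun h1 => huniq _ h1 (E.mem_ed_left i)
    have h3 : E.HasChordAt c i → ∀ k, e ≠ E.ed k := by
      rintro ⟨e', h4, h5, h6⟩
      rwa [huniq e' h4 h5]
    have h4 := h.ed_pred_ne i
    by_cases hw : ∃ k, e = E.ed k
    · have n3 : ¬ E.HasChordAt c i := fun h5 => by
        obtain ⟨k, hk⟩ := hw
        exact h3 h5 k hk
      obtain ⟨k, rfl⟩ := hw
      rcases hi.eq_of_mem_ed hm with h5 | h5
      · have n2 : ¬ 0 < c (E.ed i) := fun h6 => h4 (h5.symm.trans (h2 h6))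
        rw [h5] at he
        simp only [he, n2, n3, if_true, if_false]; norm_num
      · have n2 : ¬ 0 < c (E.ed (i - 1)) := fun h6 => h4 ((h1 h6).symm.trans h5)
        rw [h5] at he
        simp only [he, n2, n3, if_true, if_false]; norm_num
    · push Not at hw
      have n1 : ¬ 0 < c (E.ed (i - 1)) := fun h5 => hw _ (h1 h5)
      have n2 : ¬ 0 < c (E.ed i) := fun h5 => hw _ (h2 h5)
      have n3 : E.HasChordAt c i := ⟨e, he, hm, hw⟩
      simp only [n1, n2, n3, if_true, if_false]; norm_num
  · have n3 : ¬ E.HasChordAt c i := by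
      intro h3
      obtain ⟨e, j, -, h4, h5⟩ := h3.exists_eq hc
      exact hi (h.chord_single e i j h4 h5)
    obtain ⟨j, hij, hj, hv⟩ := (not_single_iff E).1 hi
    have a1 := inner_pos_iff h hc hij hj hv
    have a2 := inner_pos_iff h hc (s := j) (j := i + E.n) hj (by omega) (by rw [E.v_add_n, hv])
    have a3 := inner_add_inner h hc hij hj hv
    have a4 := even_inner h hc hij hj hv
    have a5 := even_inner h hc (s := j) (j := i + E.n) hj (by omega) (by rw [E.v_add_n, hv])
    have h4 : E.ed (i + E.n - 1) = E.ed (i - 1) := by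
      rw [← E.ed_add_n (i - 1)]; congr 1; ring
    rw [h4] at a2
    rw [Nat.even_iff] at a4 a5
    have a6 : 0 < c (E.ed (i - 1)) ↔ ¬ 0 < c (E.ed i) := by
      rw [← a2.2, ← a1.1]; omega
    by_cases h6 : 0 < c (E.ed i)
    · have : ¬ 0 < c (E.ed (i - 1)) := fun h7 => a6.1 h7 h6
      simp only [h6, this, n3, if_true, if_false]; norm_num
    · have := a6.2 h6
      simp only [h6, this, n3, if_true, if_false]; norm_num

/-- A fiber element contains no chord. -/
theorem no_chord (h : E.IsRigid) (hc : aDegree edgeVector c = aDegree edgeVector E.plus)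
    (m : ℕ) : ∀ s j e, s < j → j < s + E.n → j - s ≤ m → 0 < c e → E.IsChordEdge e →
      (e : Sym2 V) = s(E.v s, E.v j) → False := by
  classical
  induction m with
  | zero => intro s j e h1 _ h2; omega
  | succ m ih =>
    intro s j e hsj hj hm hpos hch he
    have hcs : E.HasChordAt c s := ⟨e, hpos, by rw [he]; exact Sym2.mem_mk_left _ _, hch.1⟩
    have hcj : E.HasChordAt c j := ⟨e, hpos, by rw [he]; exact Sym2.mem_mk_right _ _, hch.1⟩
    have hev := h.chord_even e s j hch he
    have x1 : ¬ 0 < c (E.ed s) := by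
      intro hx
      have := exactly_one h hc s
      rw [if_pos hcs, if_pos hx] at this
      split_ifs at this <;> omega
    have x2 : ¬ 0 < c (E.ed (j - 1)) := by
      intro hx
      have := exactly_one h hc j
      rw [if_pos hcj, if_pos hx] at this
      split_ifs at this <;> omega
    let x : ℤ → ℤ := fun i => if 0 < c (E.ed i) then 1 else 0
    let y : ℤ → ℤ := fun i => if E.HasChordAt c i then 1 else 0
    have hxy : ∀ i, x (i - 1) + x i + y i = 1 := fun i => exactly_one h hc i
    -- The chord occupies the indices `s` and `j`, so the edges next to it on the arc are not in `c`
    -- and both boundary terms of the telescoping sum vanish.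
    have t1 : ∑ i ∈ Finset.Ico (s + 1) j, sgn i * (x (i - 1) + x i) = 0 := by
      have := sum_Ico_sub_succ (fun i => sgn i * x (i - 1)) (show s + 1 ≤ j by omega)
      have e1 : x (s + 1 - 1) = 0 := by rw [add_sub_cancel_right]; exact if_neg x1
      have e2 : x (j - 1) = 0 := if_neg x2
      simp only [e1, e2, mul_zero, sub_zero] at this
      rw [← this]
      refine Finset.sum_congr rfl fun i _ => ?_
      rw [sgn_add_one, add_sub_cancel_right]; ring
    have t2 : 2 * ∑ i ∈ Finset.Ico (s + 1) j, sgn i = -2 * sgn s := by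
      have := sum_Ico_sub_succ sgn (show s + 1 ≤ j by omega)
      rw [sgn_add_one, sgn_eq_of_even_sub hev] at this
      rw [Finset.mul_sum]
      calc _ = ∑ i ∈ Finset.Ico (s + 1) j, (sgn i - sgn (i + 1)) := by
            refine Finset.sum_congr rfl fun i _ => ?_
            rw [sgn_add_one]; ring
        _ = _ := by rw [this]; ring
    have t3 : ∑ i ∈ Finset.Ico (s + 1) j, sgn i * y i = -sgn s := by
      have : ∑ i ∈ Finset.Ico (s + 1) j, sgn i =
          ∑ i ∈ Finset.Ico (s + 1) j, sgn i * (x (i - 1) + x i) +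
            ∑ i ∈ Finset.Ico (s + 1) j, sgn i * y i := by
        rw [← Finset.sum_add_distrib]
        refine Finset.sum_congr rfl fun i _ => ?_
        rw [← mul_add, hxy, mul_one]
      omega
    -- The alternating sum of the chord ends over the arc equals that of the constant 1, namely
    -- `-sgn s`; so some chord end has parity opposite to `s`.
    obtain ⟨i, hsi, hij, hodd, hci⟩ : ∃ i, s < i ∧ i < j ∧ Odd (i - s) ∧ E.HasChordAt c i := by
      by_contra hcon
      push Not at hcon
      have hnn : 0 ≤ ∑ i ∈ Finset.Ico (s + 1) j, sgn s * (sgn i * y i) := by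
        refine Finset.sum_nonneg fun i hi => ?_
        rw [Finset.mem_Ico] at hi
        by_cases hy : E.HasChordAt c i
        · have hev' : Even (i - s) := by
            by_contra hodd
            exact hcon i (by omega) (by omega) (Int.not_even_iff_odd.1 hodd) hy
          rw [sgn_eq_of_even_sub hev', ← mul_assoc, sgn_mul_self, one_mul]
          simp only [y]; split_ifs; omega
        · simp only [y, if_neg hy, mul_zero, le_refl]
      rw [← Finset.mul_sum, t3, mul_neg, sgn_mul_self] at hnn
      omega
    obtain ⟨e', b, hpos', hch', he'⟩ := hci.exists_eq hc
    obtain ⟨q, hb1, hb2⟩ := E.exists_rep s b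
    obtain ⟨k, hk⟩ : ∃ k, k = b + q * E.n := ⟨_, rfl⟩
    have hvk : E.v b = E.v k := by rw [hk, E.v_add_mul_n]
    rw [← hk] at hb1 hb2
    rw [hvk] at he'
    have hev' := h.chord_even e' i k hch' he'
    have hki : k ≠ i := by
      rintro rfl
      have := e'.2
      rw [he'] at this
      exact G.irrefl this
    rw [Int.odd_iff] at hodd
    rw [Int.even_iff] at hev hev'
    -- If the second chord ends before `j` it spans fewer steps than the first and induction
    -- applies. It cannot end at `j` by parity, and beyond `j` the two chords cross effectively.
    rcases lt_or_gt_of_ne hki with hki | hki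
    · exact ih k i e' hki (by omega) (by omega) hpos' hch' (by rw [he', Sym2.eq_swap])
    · rcases (by omega : k < j ∨ k = j ∨ j < k) with hkj | hkj | hkj
      · exact ih i k e' hki (by omega) (by omega) hpos' hch' he'
      · omega
      · exact h.chord_cross e e' s j i k hch he hch' he' hsi hij hkj hb2 (Int.odd_iff.2 hodd)

theorem not_hasChordAt (h : E.IsRigid) (hc : aDegree edgeVector c = aDegree edgeVector E.plus)
    (i : ℤ) : ¬ E.HasChordAt c i := by
  intro hi
  obtain ⟨e, b, hpos, hch, he⟩ := hi.exists_eq hc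
  obtain ⟨q, hb1, hb2⟩ := E.exists_rep i b
  rw [← E.v_add_mul_n b q] at he
  refine no_chord h hc (b + q * E.n - i).toNat i (b + q * E.n) e (lt_of_le_of_ne hb1 ?_) hb2
    (by omega) hpos hch he
  intro h1
  have := e.2
  rw [he, ← h1] at this
  exact G.irrefl this

theorem pos_pred_iff (h : E.IsRigid) (hc : aDegree edgeVector c = aDegree edgeVector E.plus)
    (i : ℤ) : 0 < c (E.ed (i - 1)) ↔ ¬ 0 < c (E.ed i) := by
  classical
  have := exactly_one h hc i
  rw [if_neg (not_hasChordAt h hc i)] at this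
  split_ifs at this with h1 h2 <;> tauto

-- A vertex visited once bounds the multiplicity by 1. If neither end is single, the sink condition
-- says that the edge is both inner edges of its coincidence, so its multiplicity is even, positive
-- and at most 2.
open Classical in
theorem apply_ed_of_pos (h : E.IsRigid) (hc : aDegree edgeVector c = aDegree edgeVector E.plus)
    {i : ℤ} (hi : 0 < c (E.ed i)) :
    c (E.ed i) = if E.Single i ∨ E.Single (i + 1) then 1 else 2 := by
  split_ifs with hs
  · rcases hs with hs | hs
    · exact eq_one_of_single hc hs hi (E.mem_ed_left i)
    · exact eq_one_of_single hc hs hi (E.mem_ed_right i)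
  · push Not at hs
    obtain ⟨j, hij, hj, hv⟩ := (not_single_iff E).1 hs.1
    have he : E.ed i = E.ed (j - 1) := by
      by_contra he
      exact hs.2 (h.sink i j hij hj hv he)
    have h1 := even_inner h hc hij hj hv
    have h2 := inner_add_inner h hc hij hj hv
    rw [inner_of_eq he] at h1 h2
    rw [Nat.even_iff] at h1
    omega

/-- Without chords, membership alternates along the walk, so one index determines the support; the
positive multiplicities depend only on the walk by `apply_ed_of_pos`. -/
theorem eq_of_pos_iff (h : E.IsRigid) (hc : aDegree edgeVector c = aDegree edgeVector E.plus)
    {c' : G.edgeSet →₀ ℕ} (hc' : aDegree edgeVector c' = aDegree edgeVector E.plus)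
    (h0 : 0 < c (E.ed 0) ↔ 0 < c' (E.ed 0)) : c = c' := by
  classical
  have hall : ∀ i, 0 < c (E.ed i) ↔ 0 < c' (E.ed i) := by
    intro i
    induction i using Int.induction_on with
    | zero => exact h0
    | succ k ih =>
      have h1 := pos_pred_iff h hc (k + 1)
      have h2 := pos_pred_iff h hc' (k + 1)
      rw [add_sub_cancel_right] at h1 h2
      tauto
    | pred k ih =>
      rw [pos_pred_iff h hc, pos_pred_iff h hc', ih]
  have hzero : ∀ d : G.edgeSet →₀ ℕ, aDegree edgeVector d = aDegree edgeVector E.plus →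
      ∀ e, (∀ i, e ≠ E.ed i) → d e = 0 := by
    intro d hd e he
    by_contra hne
    have hpos := Nat.pos_of_ne_zero hne
    obtain ⟨⟨x, y⟩, hxy⟩ := Quot.exists_rep (e : Sym2 V)
    have hx : x ∈ (e : Sym2 V) := by rw [← hxy]; exact Sym2.mem_mk_left _ _
    obtain ⟨i, rfl⟩ := exists_index_of_pos hd hpos hx
    exact not_hasChordAt h hd i ⟨e, hpos, hx, he⟩
  ext e
  by_cases he : ∃ i, e = E.ed i
  · obtain ⟨i, rfl⟩ := he
    by_cases hi : 0 < c (E.ed i)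
    · rw [apply_ed_of_pos h hc hi, apply_ed_of_pos h hc' ((hall i).1 hi)]
    · have := (hall i).not.1 hi
      omega
  · push Not at he
    rw [hzero c hc e he, hzero c' hc' e he]

/-- The fiber of a rigid circuit consists of two coprime monomials. -/
theorem IsRigid.fiber (h : E.IsRigid) :
    (∀ c, aDegree edgeVector c = aDegree edgeVector E.plus → c = E.plus ∨ c = E.minus) ∧
      ∀ e, E.plus e = 0 ∨ E.minus e = 0 := by
  have hm : aDegree edgeVector E.minus = aDegree edgeVector E.plus :=
    E.aDegree_plus_eq_minus.symm
  have h0 : 0 < E.plus (E.ed 0) := E.plus_pos_of_even Even.zero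
  have h1 : ¬ 0 < E.minus (E.ed 0) := by
    have := pos_pred_iff h hm 1
    rw [sub_self] at this
    exact fun h2 => this.1 h2 (E.minus_pos_of_odd odd_one)
  refine ⟨fun c hc => ?_, fun e => ?_⟩
  · by_cases h2 : 0 < c (E.ed 0)
    · exact Or.inl (eq_of_pos_iff h hc rfl (by tauto))
    · exact Or.inr (eq_of_pos_iff h hc hm (by tauto))
  · have hpar : ∀ i, (0 < E.plus (E.ed i) ↔ ¬ 0 < E.minus (E.ed i)) := by
      intro i
      induction i using Int.induction_on with
      | zero => tauto
      | succ k ih =>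
        have h1 := pos_pred_iff h rfl (k + 1)
        have h2 := pos_pred_iff h hm (k + 1)
        rw [add_sub_cancel_right] at h1 h2
        tauto
      | pred k ih =>
        rw [pos_pred_iff h rfl, pos_pred_iff h hm, ih]
    by_contra hcon
    push Not at hcon
    obtain ⟨i, -, rfl⟩ := E.exists_of_plus_pos (Nat.pos_of_ne_zero hcon.1)
    exact (hpar i).1 (Nat.pos_of_ne_zero hcon.1) (Nat.pos_of_ne_zero hcon.2)

end Fiber

/-! ### Exchanging the edges of an alternating set of indices -/

/-- The fiber of the monomials of the circuit consists of two coprime monomials. -/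
def IsTwoFiber (E : EvenCircuit G) : Prop :=
  (∀ c, aDegree edgeVector c = aDegree edgeVector E.plus → c = E.plus ∨ c = E.minus) ∧
    ∀ e, E.plus e = 0 ∨ E.minus e = 0

/-- Removing from `E⁺` the even edges of `S` and inserting its odd edges together with `g` preserves
the degree. `S` has to lie in one period for its even edges to divide `E⁺`. -/
theorem IsTwoFiber.exchange_plus (hF : E.IsTwoFiber) {S : Finset ℤ} {t : ℤ}
    (hS : S ⊆ Finset.Ico t (t + E.n)) {g : G.edgeSet →₀ ℕ}
    (hg : aDegree edgeVector g = E.altDegree S) :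
    ∃ r, E.plus = E.part (S.filter Even) + r ∧
      (r + E.part (S.filter Odd) + g = E.plus ∨ r + E.part (S.filter Odd) + g = E.minus) := by
  obtain ⟨r, hr⟩ := le_iff_exists_add.1 (E.part_mono (Finset.filter_subset_filter Even hS))
  rw [← E.plus_eq t] at hr
  refine ⟨r, hr, hF.1 _ ?_⟩
  rw [hr, aDegree_add, aDegree_add, aDegree_add, hg, ← E.aDegree_sub_eq_altDegree]
  abel

theorem IsTwoFiber.exchange_minus (hF : E.IsTwoFiber) {S : Finset ℤ} {t : ℤ}
    (hS : S ⊆ Finset.Ico t (t + E.n)) {g : G.edgeSet →₀ ℕ}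
    (hg : aDegree edgeVector g = -E.altDegree S) :
    ∃ r, E.minus = E.part (S.filter Odd) + r ∧
      (r + E.part (S.filter Even) + g = E.plus ∨ r + E.part (S.filter Even) + g = E.minus) := by
  obtain ⟨r, hr⟩ := le_iff_exists_add.1 (E.part_mono (Finset.filter_subset_filter Odd hS))
  rw [← E.minus_eq t] at hr
  refine ⟨r, hr, hF.1 _ ?_⟩
  rw [E.aDegree_plus_eq_minus, hr, aDegree_add, aDegree_add, aDegree_add, hg,
    ← E.aDegree_sub_eq_altDegree]
  abel

/-- The inserted edges survive in the exchanged monomial, which is `E⁺` or `E⁻`. For a chord this is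
a contradiction. The sign decides whether the exchange is made in `E⁺` or in `E⁻`. -/
theorem IsTwoFiber.exists_of_altDegree (hF : E.IsTwoFiber) {S : Finset ℤ} {t : ℤ}
    (hS : S ⊆ Finset.Ico t (t + E.n)) {g : G.edgeSet →₀ ℕ} (m : ℤ)
    (hg : E.altDegree S = sgn m • aDegree edgeVector g) {e : G.edgeSet} (he : 0 < g e) :
    ∃ i, e = E.ed i := by
  have key : 0 < E.plus e ∨ 0 < E.minus e := by
    rcases Int.even_or_odd m with h | h
    · rw [sgn_of_even h, one_smul] at hg
      obtain ⟨r, -, h1 | h1⟩ := hF.exchange_plus hS hg.symm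
      · left; rw [← h1, Finsupp.add_apply]; omega
      · right; rw [← h1, Finsupp.add_apply]; omega
    · rw [sgn_of_odd h, neg_one_smul] at hg
      obtain ⟨r, -, h1 | h1⟩ := hF.exchange_minus hS (g := g) (by rw [hg, neg_neg])
      · left; rw [← h1, Finsupp.add_apply]; omega
      · right; rw [← h1, Finsupp.add_apply]; omega
  rcases key with h | h
  · obtain ⟨i, -, rfl⟩ := E.exists_of_plus_pos h
    exact ⟨i, rfl⟩
  · obtain ⟨i, -, rfl⟩ := E.exists_of_minus_pos h
    exact ⟨i, rfl⟩

theorem aDegree_single_of_eq {e : G.edgeSet} {a b : V} (he : (e : Sym2 V) = s(a, b)) :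
    aDegree edgeVector (Finsupp.single e 1) = Finsupp.single a (1 : ℤ) + Finsupp.single b 1 := by
  obtain ⟨e, he'⟩ := e
  obtain rfl : e = s(a, b) := he
  rw [aDegree_single, one_smul, edgeVector_mk]

/-- At an odd distance the two end terms of the alternating degree of the arc have the same sign and
add up to the degree of the chord. -/
theorem IsTwoFiber.chord_even (hF : E.IsTwoFiber) {e : G.edgeSet} {s j : ℤ}
    (hch : E.IsChordEdge e) (he : (e : Sym2 V) = s(E.v s, E.v j)) : Even (j - s) := by
  by_contra hodd
  rw [Int.not_even_iff_odd] at hodd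
  obtain ⟨q, h1, h2⟩ := E.exists_rep s j
  have hj : Odd (j + q * E.n - s) := by
    rw [show j + q * E.n - s = (j - s) + q * E.n by ring]
    exact hodd.add_even (E.even_n.mul_left q)
  obtain ⟨i, hi⟩ := hF.exists_of_altDegree (S := Finset.Ico s (j + q * E.n)) (t := s)
    (g := Finsupp.single e 1) (e := e)
    (Finset.Ico_subset_Ico le_rfl h2.le) s (by
      rw [E.altDegree_Ico h1, aDegree_single_of_eq he, sgn_eq_neg_of_odd_sub hj,
        E.v_add_mul_n, smul_add, neg_smul, sub_neg_eq_add]) (by simp)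
  exact hch.1 i hi

/-- The interval from `l` to `j` joins the ends of `E.ed s` with the signs of that edge, and does
not contain it. The exchange therefore inserts one more copy of `E.ed s`: it cannot return the
original monomial, and the opposite one is coprime to this edge. -/
theorem IsTwoFiber.sink (hF : E.IsTwoFiber) (h : E.IsCactus) {s j l : ℤ} (hsl : s + 1 < l)
    (hlj : l + 1 < j) (hj : j < s + E.n) (hv : E.v s = E.v j) (hv' : E.v (s + 1) = E.v l) :
    False := by
  have hodd1 := h.odd s j (by omega) hj hv
  have hodd2 := h.odd (s + 1) l hsl (by omega) hv'
  rw [Int.odd_iff] at hodd1 hodd2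
  have hne : ∀ k, l ≤ k → k < j → E.ed k ≠ E.ed s := by
    intro k h1 h2 he
    have he' := congrArg Subtype.val he
    rw [coe_ed, coe_ed, Sym2.eq_iff] at he'
    rcases he' with ⟨h3, -⟩ | ⟨h3, h4⟩
    · exact h.ne_of_lt (by omega) hj hv (by omega) (by omega) h2.ne h3
    · rcases h1.eq_or_lt with h1 | h1
      · rw [← h1] at h4
        exact h.ne_of_lt (k := l + 1) (by omega) hj hv (by omega) (by omega) (by omega) h4
      · exact h.ne_of_lt (k := k) hsl (by omega) hv' (by omega) (by omega) (by omega) h3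
  have hzero : ∀ p : ℤ → Prop, [DecidablePred p] →
      E.part ((Finset.Ico l j).filter p) (E.ed s) = 0 := by
    intro p _
    by_contra h0
    obtain ⟨k, hk, hk'⟩ := E.part_pos_iff.1 (Nat.pos_of_ne_zero h0)
    rw [Finset.mem_filter, Finset.mem_Ico] at hk
    exact hne k hk.1.1 hk.1.2 hk'
  have halt : E.altDegree (Finset.Ico l j) =
      sgn s • aDegree edgeVector (Finsupp.single (E.ed s) 1) := by
    rw [E.altDegree_Ico (by omega), aDegree_single_of_eq (E.coe_ed s), hv, hv',
      sgn_eq_neg_of_odd_sub (i := s) (j := j) (Int.odd_iff.2 (by omega)),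
      sgn_eq_of_even_sub (i := s) (j := l) (Int.even_iff.2 (by omega)), smul_add, neg_smul,
      sub_neg_eq_add, add_comm]
  have hS : Finset.Ico l j ⊆ Finset.Ico s (s + E.n) := Finset.Ico_subset_Ico (by omega) (by omega)
  have hdisj := hF.2 (E.ed s)
  rcases Int.even_or_odd s with hs | hs
  · have hpos := E.plus_pos_of_even hs
    rw [sgn_of_even hs, one_smul] at halt
    obtain ⟨r, h1, h2 | h2⟩ := hF.exchange_plus hS halt.symm
    · have h3 := DFunLike.congr_fun (h2.trans h1) (E.ed s)
      simp only [Finsupp.add_apply, hzero, Finsupp.single_eq_same] at h3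
      omega
    · have h3 := DFunLike.congr_fun h2 (E.ed s)
      simp only [Finsupp.add_apply, Finsupp.single_eq_same] at h3
      omega
  · have hpos := E.minus_pos_of_odd hs
    rw [sgn_of_odd hs, neg_one_smul] at halt
    obtain ⟨r, h1, h2 | h2⟩ := hF.exchange_minus hS (g := Finsupp.single (E.ed s) 1)
      (by rw [halt, neg_neg])
    · have h3 := DFunLike.congr_fun h2 (E.ed s)
      simp only [Finsupp.add_apply, Finsupp.single_eq_same] at h3
      omega
    · have h3 := DFunLike.congr_fun (h2.trans h1) (E.ed s)
      simp only [Finsupp.add_apply, hzero, Finsupp.single_eq_same] at h3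
      omega

/-- Two coincidences at the ends of an edge that is traversed once enclose each other. -/
theorem IsCactus.nested (h : E.IsCactus) {s j : ℤ} (hsj : s < j) (hj : j < s + E.n)
    (hv : E.v s = E.v j) (hne : E.ed s ≠ E.ed (j - 1)) (hs : ¬ E.Single (s + 1)) :
    ∃ l, s + 1 < l ∧ l + 1 < j ∧ E.v (s + 1) = E.v l := by
  obtain ⟨l, h1, h2, h3⟩ := (not_single_iff E).1 hs
  refine ⟨l, h1, ?_, h3⟩
  by_contra hcon
  rcases (by omega : l = j - 1 ∨ l = j ∨ (j < l ∧ l < s + E.n) ∨ l = s + E.n) with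
    rfl | rfl | ⟨h4, h5⟩ | rfl
  · apply hne
    apply Subtype.ext
    rw [coe_ed, coe_ed, sub_add_cancel, ← hv, ← h3, Sym2.eq_swap]
  · exact E.ne_succ s (hv.trans h3.symm)
  · have h6 := h.three_le hsj hj hv
    exact h.noncross s (s + 1) j l (by omega) (by omega) h4 h5 hv h3
  · rw [E.v_add_n] at h3
    exact E.ne_succ s h3.symm

theorem IsTwoFiber.isRigid (hF : E.IsTwoFiber) (h : E.IsCactus) : E.IsRigid where
  toIsCactus := h
  sink s j hsj hj hv hne := by
    by_contra hs
    obtain ⟨l, h1, h2, h3⟩ := h.nested hsj hj hv hne hs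
    exact hF.sink h h1 h2 hj hv h3
  chord_even e s j hch he := hF.chord_even hch he
  -- A second visit at odd distance would put the same chord at both an even and an odd distance.
  chord_single e s j hch he := by
    by_contra hs
    obtain ⟨k, h1, h2, h3⟩ := (not_single_iff E).1 hs
    have e1 := hF.chord_even hch he
    have e2 := hF.chord_even (s := k) (j := j) hch (by rw [he, h3])
    have e3 := h.odd s k h1 h2 h3
    rw [Int.even_iff] at e1 e2
    rw [Int.odd_iff] at e3
    omega
  chord_sep e s j hch he k l hks hsl hlj hj hv := by
    have e1 := hF.chord_even hch he
    have e2 := h.odd k l (by omega) (by omega) hv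
    -- The gap from `k` to `l` is odd, so their end terms cancel. The terms of `s` and `j` have
    -- equal signs and give the degree of the chord with sign `sgn (s + 1)`.
    obtain ⟨i, hi⟩ := hF.exists_of_altDegree (S := Finset.Ico k s ∪ Finset.Ico l j) (t := k)
      (g := Finsupp.single e 1) (e := e) (by
        intro x hx
        simp only [Finset.mem_union, Finset.mem_Ico] at hx ⊢
        omega) (s + 1) (by
        rw [E.altDegree_union (by
            rw [Finset.disjoint_left]
            intro x hx hx'
            rw [Finset.mem_Ico] at hx hx'
            omega), E.altDegree_Ico hks.le, E.altDegree_Ico hlj.le, aDegree_single_of_eq he,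
          sgn_eq_neg_of_odd_sub e2, sgn_eq_of_even_sub e1, hv, sgn_add_one]
        simp only [neg_smul, smul_add]
        abel) (by simp)
    exact hch.1 i hi
  chord_cross e e' s j s' j' hch he hch' he' hss' hsj hjj' hj' hodd := by
    have e1 := hF.chord_even hch he
    have e2 := hF.chord_even hch' he'
    -- Both chords span even distances and `s' - s` is odd, so all four end terms have the sign of
    -- `s` and give the degree of the two chords together.
    obtain ⟨i, hi⟩ := hF.exists_of_altDegree (S := Finset.Ico s s' ∪ Finset.Ico j j') (t := s)
      (g := Finsupp.single e 1 + Finsupp.single e' 1) (e := e) (by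
        intro x hx
        simp only [Finset.mem_union, Finset.mem_Ico] at hx ⊢
        omega) s (by
        rw [E.altDegree_union (by
            rw [Finset.disjoint_left]
            intro x hx hx'
            rw [Finset.mem_Ico] at hx hx'
            omega), E.altDegree_Ico hss'.le, E.altDegree_Ico hjj'.le, aDegree_add,
          aDegree_single_of_eq he, aDegree_single_of_eq he',
          sgn_eq_of_even_sub e2, sgn_eq_of_even_sub e1, sgn_eq_neg_of_odd_sub hodd]
        simp only [neg_smul, smul_add]
        abel) (by simp)
    exact hch.1 i hi

end EvenCircuit

section Graph

variable {V : Type*} {G : SimpleGraph V}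

/-! ### Biconnected subgraphs and blocks -/

/-- Rotated to start at the deleted vertex, the cycle without its two extreme edges is a path
through all other vertices. -/
theorem isBiconnected_toSubgraph {x : V} {c : G.Walk x x} (hc : c.IsCycle) :
    IsBiconnected c.toSubgraph := by
  classical
  refine ⟨c.toSubgraph_connected, fun v hv => ?_⟩
  rw [Walk.mem_verts_toSubgraph] at hv
  rw [← c.toSubgraph_rotate hv]
  have hc' := hc.rotate hv
  obtain ⟨c', hcc'⟩ : ∃ c', c' = c.rotate v hv := ⟨_, rfl⟩
  rw [← hcc'] at hc' ⊢
  clear hcc'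
  have h3 := hc'.three_le_length
  have hnil : ¬ c'.Nil := hc'.not_nil
  have hp : c'.tail.IsPath := hc'.isPath_tail
  have hnil' : ¬ c'.tail.Nil := by
    rw [Walk.not_nil_iff_lt_length]
    have := c'.length_tail_add_one hnil
    omega
  have hsupp : c'.tail.dropLast.support ++ [v] = c'.tail.support :=
    Walk.support_dropLast_concat hnil'
  have hv' : v ∉ c'.tail.dropLast.support := by
    have := hp.support_nodup
    rw [← hsupp, List.nodup_append] at this
    intro h
    exact this.2.2 v h v (by simp) rfl
  have hsupp' : ∀ u, u ∈ c'.support ↔ u = v ∨ u ∈ c'.tail.dropLast.support := by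
    intro u
    rw [← Walk.cons_support_tail hnil, List.mem_cons, ← hsupp, List.mem_append,
      List.mem_singleton]
    tauto
  refine (Subgraph.Connected.mono ?_ ?_ (Walk.toSubgraph_connected c'.tail.dropLast)).preconnected
  · refine ⟨fun u hu => ?_, fun a b hab => ?_⟩
    · rw [Walk.mem_verts_toSubgraph] at hu
      refine ⟨(Walk.mem_verts_toSubgraph _).2 ((hsupp' u).2 (Or.inr hu)), ?_⟩
      rintro rfl
      exact hv' hu
    · have ha := (Walk.mem_verts_toSubgraph _).1 hab.fst_mem
      have hb := (Walk.mem_verts_toSubgraph _).1 hab.snd_mem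
      rw [Subgraph.deleteVerts_adj]
      refine ⟨(Walk.mem_verts_toSubgraph _).2 ((hsupp' a).2 (Or.inr ha)), ?_,
        (Walk.mem_verts_toSubgraph _).2 ((hsupp' b).2 (Or.inr hb)), ?_, ?_⟩
      · rintro rfl; exact hv' ha
      · rintro rfl; exact hv' hb
      · rw [Walk.adj_toSubgraph_iff_mem_edges] at hab ⊢
        rw [Walk.edges_dropLast] at hab
        have h1 := List.mem_of_mem_dropLast hab
        rw [← Walk.cons_tail_eq _ hnil, Walk.edges_cons]
        exact List.mem_cons_of_mem _ h1
  · ext u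
    rw [Walk.mem_verts_toSubgraph, Subgraph.deleteVerts_verts, Set.mem_sdiff,
      Walk.mem_verts_toSubgraph, hsupp', Set.mem_singleton_iff]
    constructor
    · intro hu
      exact ⟨Or.inr hu, by rintro rfl; exact hv' hu⟩
    · tauto

theorem isBiconnected_subgraphOfAdj {a b : V} (h : G.Adj a b) :
    IsBiconnected (G.subgraphOfAdj h) := by
  refine ⟨Subgraph.subgraphOfAdj_connected h, fun v hv => ⟨?_⟩⟩
  rintro ⟨x, hx⟩ ⟨y, hy⟩
  have : x = y := by
    simp only [Subgraph.deleteVerts_verts, subgraphOfAdj_verts, Set.mem_sdiff, Set.mem_insert_iff,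
      Set.mem_singleton_iff] at hx hy hv
    obtain ⟨hx, hxv⟩ := hx
    obtain ⟨hy, hyv⟩ := hy
    rcases hv with hv | hv <;> rw [hv] at hxv hyv
    · exact (hx.resolve_left hxv).trans (hy.resolve_left hyv).symm
    · exact (hx.resolve_right hxv).trans (hy.resolve_right hyv).symm
  subst this
  rfl

theorem exists_isBlock_ge [Finite V] {H B : G.Subgraph} (hB : B ≤ H) (hb : IsBiconnected B) :
    ∃ B', B ≤ B' ∧ IsBlock H B' :=
  Finite.exists_le_maximal ⟨hB, hb⟩

theorem exists_isBlock_adj [Finite V] {H : G.Subgraph} {a b : V} (h : H.Adj a b) :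
    ∃ B, IsBlock H B ∧ B.Adj a b := by
  have hle : G.subgraphOfAdj h.adj_sub ≤ H := by
    refine ⟨?_, fun x y hxy => ?_⟩
    · rw [subgraphOfAdj_verts]
      rintro x (rfl | rfl)
      exacts [h.fst_mem, h.snd_mem]
    · rw [subgraphOfAdj_adj, Sym2.eq_iff] at hxy
      rcases hxy with ⟨rfl, rfl⟩ | ⟨rfl, rfl⟩
      exacts [h, h.symm]
  obtain ⟨B, h1, h2⟩ := exists_isBlock_ge hle (isBiconnected_subgraphOfAdj h.adj_sub)
  exact ⟨B, h2, h1.2 (by simp)⟩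

theorem exists_adj_of_preconnected {B : G.Subgraph} (hB : B.Preconnected) {p q : V}
    (hp : p ∈ B.verts) (hq : q ∈ B.verts) (hpq : p ≠ q) : ∃ r, B.Adj p r := by
  obtain ⟨w⟩ := hB.coe ⟨p, hp⟩ ⟨q, hq⟩
  cases w with
  | nil => exact absurd rfl hpq
  | cons h _ => exact ⟨_, h⟩

theorem exists_boundary_adj {B : G.Subgraph} (hB : B.Preconnected) (X : Set V) {p q : V}
    (hp : p ∈ B.verts) (hq : q ∈ B.verts) (hpX : p ∈ X) (hqX : q ∉ X) :
    ∃ a b, B.Adj a b ∧ a ∈ X ∧ b ∉ X := by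
  obtain ⟨w⟩ := hB.coe ⟨p, hp⟩ ⟨q, hq⟩
  obtain ⟨d, -, h1, h2⟩ := w.exists_boundary_dart {x | (x : V) ∈ X} hpX hqX
  exact ⟨_, _, d.adj, h1, h2⟩

end Graph

/-! ### Blocks of the graph of a circuit -/

namespace EvenCircuit

variable {V : Type*} {G : SimpleGraph V} {E : EvenCircuit G}

/-- The subgraph formed by the vertices and edges of the circuit. -/
def sub (E : EvenCircuit G) : G.Subgraph where
  verts := Set.range E.v
  Adj a b := ∃ i, s(a, b) = s(E.v i, E.v (i + 1))
  adj_sub := by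
    rintro a b ⟨i, hi⟩
    rw [← SimpleGraph.mem_edgeSet, hi]
    exact E.adj i
  edge_vert := by
    rintro a b ⟨i, hi⟩
    rcases Sym2.eq_iff.1 hi with ⟨rfl, -⟩ | ⟨rfl, -⟩
    exacts [⟨_, rfl⟩, ⟨_, rfl⟩]
  symm := by
    constructor
    rintro a b ⟨i, hi⟩
    exact ⟨i, by rw [Sym2.eq_swap, hi]⟩

theorem exists_rep_of_adj {a b : V} (h : E.sub.Adj a b) (t : ℤ) :
    ∃ i, t ≤ i ∧ i < t + E.n ∧ s(a, b) = s(E.v i, E.v (i + 1)) := by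
  obtain ⟨i, hi⟩ := h
  obtain ⟨q, h1, h2⟩ := E.exists_rep t i
  refine ⟨_, h1, h2, ?_⟩
  rw [hi, add_right_comm, E.v_add_mul_n, E.v_add_mul_n]

/-- A biconnected subgraph lies on one side of a coincidence. -/
theorem IsCactus.one_side (h : E.IsCactus) {B : G.Subgraph} (hB : B ≤ E.sub)
    (hb : IsBiconnected B) {t m k l : ℤ} (htm : t < m) (hm : m < t + E.n) (hv : E.v t = E.v m)
    (htk : t < k) (hkm : k < m) (hml : m < l) (hlt : l < t + E.n) (hk : E.v k ∈ B.verts)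
    (hl : E.v l ∈ B.verts) : False := by
  have hmem : ∀ k, t ≤ k → k ≤ t + E.n → (E.v k ∈ E.inside t m ↔ t < k ∧ k < m) :=
    fun k => h.mem_inside_iff htm hm hv
  have hpre : (B.deleteVerts {E.v t}).Preconnected := by
    by_cases hp : E.v t ∈ B.verts
    · exact hb.2 _ hp
    · rw [← B.deleteVerts_inter_verts_set_right_eq, Set.singleton_inter_eq_empty.2 hp,
        Subgraph.deleteVerts_empty]
      exact hb.1.preconnected
  have hkt : E.v k ≠ E.v t := h.ne_of_lt htm hm hv htk (by omega) (by omega)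
  have hlt' : E.v l ≠ E.v t := h.ne_of_lt htm hm hv (by omega) hlt (by omega)
  -- With the vertex of the coincidence deleted, `B` would still need an edge leaving the inside.
  -- But every edge of the walk that does so ends at that vertex.
  obtain ⟨a, b, hab, ha, hb'⟩ := exists_boundary_adj hpre (E.inside t m) ⟨hk, hkt⟩ ⟨hl, hlt'⟩
    ((hmem k (by omega) (by omega)).2 ⟨htk, hkm⟩)
    (fun h1 => by have := (hmem l (by omega) (by omega)).1 h1; omega)
  rw [Subgraph.deleteVerts_adj] at hab
  obtain ⟨i, h1, h2, h3⟩ := exists_rep_of_adj (hB.2 hab.2.2.2.2) t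
  have e1 := hmem i h1 h2.le
  have e2 := hmem (i + 1) (by omega) (by omega)
  rcases Sym2.eq_iff.1 h3 with ⟨rfl, rfl⟩ | ⟨rfl, rfl⟩
  · rw [e1] at ha
    rw [e2] at hb'
    rw [show i + 1 = m by omega, ← hv] at hab
    exact hab.2.2.2.1 rfl
  · rw [e2] at ha
    rw [e1] at hb'
    rw [show i = t by omega] at hab
    exact hab.2.2.2.1 rfl

/-- The indices `i` and `k` are separated by a coincidence. -/
def Sep (E : EvenCircuit G) (i k : ℤ) : Prop :=
  ∃ t m, i < t ∧ t ≤ k ∧ k < m ∧ m ≤ i + E.n ∧ E.v t = E.v m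

/-- An edge on either side of a coincidence has an end other than its vertex, so two separated edges
give `one_side` a vertex on each side. -/
theorem IsCactus.not_sep (h : E.IsCactus) {B : G.Subgraph} (hB : B ≤ E.sub)
    (hb : IsBiconnected B) {i k : ℤ} (hi : B.Adj (E.v i) (E.v (i + 1)))
    (hk : B.Adj (E.v k) (E.v (k + 1))) : ¬ E.Sep i k := by
  rintro ⟨t, m, h1, h2, h3, h4, hv⟩
  have h5 := h.three_le (s := t) (j := m) (by omega) (by omega) hv
  have h6 := h.le_three (s := t) (j := m) (by omega) (by omega) hv
  obtain ⟨k', hk1, hk2, hk'⟩ : ∃ k', t < k' ∧ k' < m ∧ E.v k' ∈ B.verts := by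
    by_cases h7 : t < k
    · exact ⟨k, h7, h3, hk.fst_mem⟩
    · exact ⟨k + 1, by omega, by omega, hk.snd_mem⟩
  obtain ⟨i', hi1, hi2, hi'⟩ : ∃ i', m < i' ∧ i' < t + E.n ∧ E.v i' ∈ B.verts := by
    by_cases h7 : m < i + E.n
    · exact ⟨i + E.n, h7, by omega, by rw [E.v_add_n]; exact hi.fst_mem⟩
    · exact ⟨i + 1 + E.n, by omega, by omega, by rw [E.v_add_n]; exact hi.snd_mem⟩
  exact h.one_side hB hb (by omega) (by omega) hv hk1 hk2 hi1 hi2 hk' hi'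

theorem exists_walk (E : EvenCircuit G) (a : ℤ) (m : ℕ) :
    ∃ p : G.Walk (E.v a) (E.v (a + m)), ∀ e ∈ p.edges, ∃ k, a ≤ k ∧ k < a + m ∧
      e = s(E.v k, E.v (k + 1)) := by
  induction m with
  | zero =>
    refine ⟨Walk.nil.copy rfl (by simp), ?_⟩
    simp
  | succ m ih =>
    obtain ⟨p, hp⟩ := ih
    refine ⟨(p.concat (E.adj (a + m))).copy rfl (by push_cast; rw [add_assoc]), ?_⟩
    intro e he
    rw [Walk.edges_copy, Walk.edges_concat, List.concat_eq_append, List.mem_append,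
      List.mem_singleton] at he
    push_cast
    rcases he with he | rfl
    · obtain ⟨k, h1, h2, rfl⟩ := hp e he
      exact ⟨k, h1, by omega, rfl⟩
    · exact ⟨a + m, by omega, by omega, rfl⟩

/-- An edge that is traversed once lies on a cycle, which contains all the edges that are not
separated from it. -/
theorem exists_isCycle (E : EvenCircuit G) {i : ℤ}
    (hi : ∀ k, i < k → k < i + E.n → E.ed k ≠ E.ed i) :
    ∃ c : G.Walk (E.v i) (E.v i), c.IsCycle ∧ c.toSubgraph ≤ E.sub ∧
      c.toSubgraph.Adj (E.v i) (E.v (i + 1)) ∧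
      ∀ k, i < k → k < i + E.n → ¬ E.Sep i k → c.toSubgraph.Adj (E.v k) (E.v (k + 1)) := by
  classical
  obtain ⟨p', hp'⟩ := E.exists_walk (i + 1) (E.n - 1).toNat
  have hn := E.n_pos
  have hend : i + 1 + ((E.n - 1).toNat : ℤ) = i + E.n := by omega
  simp only [hend] at hp'
  obtain ⟨p, hp, hpp⟩ : ∃ p : G.Walk (E.v (i + 1)) (E.v i), (∀ e ∈ p.edges, ∃ k, i < k ∧
      k < i + E.n ∧ e = s(E.v k, E.v (k + 1))) ∧ p.IsPath := by
    refine ⟨(p'.copy rfl (by rw [hend, E.v_add_n])).bypass, ?_, Walk.bypass_isPath _⟩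
    intro e he
    have := Walk.edges_bypass_subset_edges _ he
    rw [Walk.edges_copy] at this
    obtain ⟨k, h1, h2, h3⟩ := hp' e this
    exact ⟨k, by omega, h2, h3⟩
  have hnot : s(E.v i, E.v (i + 1)) ∉ p.edges := by
    intro hmem
    obtain ⟨k, h1, h2, h3⟩ := hp _ hmem
    exact hi k h1 h2 (Subtype.ext h3.symm)
  have hedges : ∀ e ∈ (Walk.cons (E.adj i) p).edges, ∃ k, e = s(E.v k, E.v (k + 1)) := by
    intro e he
    rw [Walk.edges_cons, List.mem_cons] at he
    rcases he with rfl | he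
    · exact ⟨i, rfl⟩
    · obtain ⟨k, -, -, h⟩ := hp e he
      exact ⟨k, h⟩
  refine ⟨Walk.cons (E.adj i) p, (Walk.cons_isCycle_iff _ _).2 ⟨hpp, hnot⟩, ?_, ?_, ?_⟩
  · have hadj : ∀ a b, (Walk.cons (E.adj i) p).toSubgraph.Adj a b → E.sub.Adj a b := by
      intro a b hab
      rw [Walk.adj_toSubgraph_iff_mem_edges] at hab
      exact hedges _ hab
    refine ⟨fun a ha => ?_, hadj⟩
    by_cases hai : a = E.v i
    · exact ⟨i, hai.symm⟩
    · obtain ⟨r, hr⟩ := exists_adj_of_preconnected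
        (Walk.cons (E.adj i) p).toSubgraph_connected.preconnected ha
        ((Walk.mem_verts_toSubgraph _).2 (Walk.start_mem_support _)) hai
      exact (hadj _ _ hr).fst_mem
  · rw [Walk.adj_toSubgraph_iff_mem_edges, Walk.edges_cons]
    exact List.mem_cons_self
  · intro k hik hk hsep
    rw [Walk.adj_toSubgraph_iff_mem_edges, Walk.edges_cons]
    refine List.mem_cons_of_mem _ ?_
    by_contra hkp
    -- `X` is the set of vertices visited from `i + 1` to `k`. As `k` is not separated from `i`,
    -- none of them recurs from `k + 1` to `i + n`; so the only edge of the rest of the walk that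
    -- leaves `X` is the edge `k`, and the path must use it.
    have hX : ∀ l, k < l → l ≤ i + E.n → E.v l ∉ {x | ∃ t, i < t ∧ t ≤ k ∧ E.v t = x} := by
      rintro l h1 h2 ⟨t, h3, h4, h5⟩
      exact hsep ⟨t, l, h3, h4, h1, h2, h5⟩
    obtain ⟨d, hd, hd1, hd2⟩ := p.exists_boundary_dart {x | ∃ t, i < t ∧ t ≤ k ∧ E.v t = x}
      ⟨i + 1, by omega, by omega, rfl⟩ (by
        rw [← E.v_add_n i]
        exact hX _ hk le_rfl)
    have hde : d.edge ∈ p.edges := List.mem_map_of_mem hd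
    obtain ⟨m, h1, h2, h3⟩ := hp _ hde
    have hmk : m ≠ k := by
      rintro rfl
      exact hkp (h3 ▸ hde)
    have h3' : s(d.fst, d.snd) = s(E.v m, E.v (m + 1)) := h3
    rcases lt_or_gt_of_ne hmk with hmk | hmk
    · rcases Sym2.eq_iff.1 h3' with ⟨h4, h5⟩ | ⟨h4, h5⟩
      · rw [h5] at hd2
        exact hd2 ⟨m + 1, by omega, by omega, rfl⟩
      · rw [h5] at hd2
        exact hd2 ⟨m, by omega, by omega, rfl⟩
    · rcases Sym2.eq_iff.1 h3' with ⟨h4, h5⟩ | ⟨h4, h5⟩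
      · rw [h4] at hd1
        exact hX m (by omega) (by omega) hd1
      · rw [h4] at hd1
        exact hX (m + 1) (by omega) (by omega) hd1

/-- A biconnected subgraph without edges separated from `i` is contained in every subgraph which
contains all the edges not separated from `i`. -/
theorem le_of_not_sep {B C : G.Subgraph} (hB : B ≤ E.sub) (hb : IsBiconnected B) {i : ℤ}
    (hi : C.Adj (E.v i) (E.v (i + 1)))
    (hC : ∀ k, i < k → k < i + E.n → ¬ E.Sep i k → C.Adj (E.v k) (E.v (k + 1)))
    (hsep : ∀ k, i < k → k < i + E.n → B.Adj (E.v k) (E.v (k + 1)) → ¬ E.Sep i k)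
    {p : V} (hpB : p ∈ B.verts) (hpC : p ∈ C.verts) : B ≤ C := by
  have hadj : ∀ a b, B.Adj a b → C.Adj a b := by
    intro a b hab
    obtain ⟨k, h1, h2, h3⟩ := exists_rep_of_adj (hB.2 hab) i
    have hk : B.Adj (E.v k) (E.v (k + 1)) := by
      rw [← Subgraph.mem_edgeSet, ← h3]; exact hab
    rw [← Subgraph.mem_edgeSet, h3, Subgraph.mem_edgeSet]
    rcases h1.eq_or_lt with rfl | h1
    · exact hi
    · exact hC k h1 h2 (hsep k h1 h2 hk)
  refine ⟨fun q hq => ?_, hadj⟩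
  by_cases hqp : q = p
  · rw [hqp]; exact hpC
  · obtain ⟨r, hr⟩ := exists_adj_of_preconnected hb.1.preconnected hq hpB hqp
    exact (hadj _ _ hr).fst_mem

/-- An edge that is traversed once lies in a cyclic block, which contains all the edges that are
not separated from it. -/
theorem IsCactus.exists_cyclic_block (h : E.IsCactus) {i : ℤ}
    (hi : ∀ k, i < k → k < i + E.n → E.ed k ≠ E.ed i) :
    ∃ C : G.Subgraph, IsBlock E.sub C ∧ IsCycleGraph C ∧ C.Adj (E.v i) (E.v (i + 1)) ∧
      ∀ k, i < k → k < i + E.n → ¬ E.Sep i k → C.Adj (E.v k) (E.v (k + 1)) := by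
  obtain ⟨c, hc, hle, hadj, hall⟩ := E.exists_isCycle hi
  refine ⟨c.toSubgraph, ⟨⟨hle, isBiconnected_toSubgraph hc⟩, ?_⟩, ⟨_, c, hc, rfl⟩, hadj, hall⟩
  -- A larger biconnected subgraph contains the edge `i`, hence no edge separated from it; the cycle
  -- already has all the others.
  rintro B ⟨hB, hb⟩ hCB
  exact le_of_not_sep hB hb hadj hall (fun k _ _ hk => h.not_sep hB hb (hCB.2 hadj) hk)
    (hCB.1 hadj.fst_mem) hadj.fst_mem

/-- Two consecutive doubled vertices joined by a doubled edge: the edge is not in a cyclic block. -/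
theorem IsCactus.not_cyclic (h : E.IsCactus) {i j : ℤ} (hij : i < j) (hj : j < i + E.n)
    (hv : E.v i = E.v j) (hv' : E.v (i + 1) = E.v (j - 1)) {B : G.Subgraph} (hB : B ≤ E.sub)
    (hb : IsBiconnected B) (hc : IsCycleGraph B) (hadj : B.Adj (E.v i) (E.v (i + 1))) : False := by
  have h3 := h.three_le hij hj hv
  have h3' := h.le_three hij hj hv
  -- The coincidences of `i, j` and of `i + 1, j - 1` confine the block to the two ends of the edge,
  -- too few for a cycle.
  have hverts : ∀ p ∈ B.verts, p = E.v i ∨ p = E.v (i + 1) := by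
    intro p hp
    obtain ⟨k, rfl⟩ := hB.1 hp
    obtain ⟨q, h1, h2⟩ := E.exists_rep i k
    rw [← E.v_add_mul_n k q] at hp ⊢
    obtain ⟨m, hm⟩ : ∃ m, m = k + q * E.n := ⟨_, rfl⟩
    rw [← hm] at h1 h2 hp ⊢
    have n1 : ¬ j < m := fun hjm =>
      h.one_side hB hb hij hj hv (k := i + 1) (by omega) (by omega) hjm h2 hadj.snd_mem hp
    have n2 : ¬ (i + 1 < m ∧ m < j - 1) := fun hm' =>
      h.one_side hB hb (by omega) (by omega) hv' hm'.1 hm'.2 (l := i + E.n) (by omega) (by omega) hp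
        (by rw [E.v_add_n]; exact hadj.fst_mem)
    rcases (by omega : m = i ∨ m = i + 1 ∨ m = j - 1 ∨ m = j) with rfl | rfl | rfl | rfl
    · exact Or.inl rfl
    · exact Or.inr rfl
    · exact Or.inr hv'.symm
    · exact Or.inl hv.symm
  obtain ⟨x, c, hc, rfl⟩ := hc
  have hedge : ∀ e ∈ c.edges, e = s(E.v i, E.v (i + 1)) := by
    intro e he
    induction e with
    | h a b =>
      rw [← Walk.adj_toSubgraph_iff_mem_edges] at he
      rcases hverts a he.fst_mem with ha | ha <;> rcases hverts b he.snd_mem with hb | hb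
      · exact absurd (ha.trans hb.symm) he.ne
      · rw [ha, hb]
      · rw [ha, hb, Sym2.eq_swap]
      · exact absurd (ha.trans hb.symm) he.ne
  have hlen := hc.three_le_length
  have hnd := hc.edges_nodup
  rw [← Walk.length_edges] at hlen
  have := (List.Nodup.getElem_inj_iff hnd (hi := (by omega : 0 < c.edges.length))
    (hj := (by omega : 1 < c.edges.length))).1
    ((hedge _ (List.getElem_mem _)).trans (hedge _ (List.getElem_mem _)).symm)
  omega

/-! ### Sinks in cyclic blocks -/

/-- A sink of the subgraph `B`. -/
def IsSinkOf (E : EvenCircuit G) (B : G.Subgraph) (p : V) : Prop :=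
  ∃ i j, 0 ≤ i ∧ i < E.n ∧ 0 ≤ j ∧ j < E.n ∧ i ≠ j ∧ (Even i ↔ Even j) ∧
    (E.ed i : Sym2 V) ∈ B.edgeSet ∧ (E.ed j : Sym2 V) ∈ B.edgeSet ∧
    p ∈ (E.ed i : Sym2 V) ∧ p ∈ (E.ed j : Sym2 V)

/-- No cyclic block has two adjacent sinks. -/
def HasNoAdjacentSinks (E : EvenCircuit G) : Prop :=
  ∀ B : G.Subgraph, IsBlock E.sub B → IsCycleGraph B →
    ∀ a b : V, E.IsSinkOf B a → E.IsSinkOf B b → ¬ B.Adj a b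

theorem isSinkOf_of_lt {B : G.Subgraph} {i j : ℤ} (hij : i < j) (hj : j < i + E.n)
    (hev : Even (j - i)) {p : V} (hi : B.Adj (E.v i) (E.v (i + 1)))
    (hj' : B.Adj (E.v j) (E.v (j + 1))) (hpi : p ∈ (E.ed i : Sym2 V))
    (hpj : p ∈ (E.ed j : Sym2 V)) : E.IsSinkOf B p := by
  obtain ⟨q, h1, h2⟩ := E.exists_rep 0 i
  obtain ⟨q', h3, h4⟩ := E.exists_rep 0 j
  have hn := E.n_pos
  refine ⟨_, _, h1, by omega, h3, by omega, ?_, ?_, ?_, ?_, ?_, ?_⟩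
  · intro h5
    have h6 : j - i = (q - q') * E.n := by linarith
    rcases le_or_gt (q - q') 0 with h7 | h7
    · nlinarith
    · nlinarith [show (1 : ℤ) ≤ q - q' from h7]
  · rw [E.even_add_mul_n, E.even_add_mul_n]
    exact (Int.even_sub.1 hev).symm
  · rw [E.ed_add_mul_n]; exact hi
  · rw [E.ed_add_mul_n]; exact hj'
  · rwa [E.ed_add_mul_n]
  · rwa [E.ed_add_mul_n]

/-- A vertex visited once meets the walk only at the indices `i - 1` and `i` modulo the even length,
which have different parity. -/
theorem IsSinkOf.not_single {B : G.Subgraph} {i : ℤ} (h : E.IsSinkOf B (E.v i)) :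
    ¬ E.Single i := by
  intro hi
  obtain ⟨k, l, hk0, hkn, hl0, hln, hne, hpar, -, -, hk, hl⟩ := h
  have aux : ∀ m, E.v i ∈ (E.ed m : Sym2 V) → ∃ q, m = i + q * E.n ∨ m + 1 = i + q * E.n := by
    intro m hm
    rcases mem_ed_iff.1 hm with hm | hm
    · obtain ⟨q, hq⟩ := hi.exists_eq hm.symm
      exact ⟨q, Or.inl hq⟩
    · obtain ⟨q, hq⟩ := hi.exists_eq hm.symm
      exact ⟨q, Or.inr hq⟩
  have key : ∀ a b q q' : ℤ, 0 ≤ a → a < E.n → 0 ≤ b → b < E.n → a - b = (q - q') * E.n → a = b := by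
    intro a b q q' h1 h2 h3 h4 h5
    rcases lt_trichotomy (q - q') 0 with h6 | h6 | h6
    · nlinarith [show q - q' ≤ -1 by omega]
    · rw [h6] at h5; omega
    · nlinarith [show 1 ≤ q - q' by omega]
  obtain ⟨q, hq⟩ := aux k hk
  obtain ⟨q', hq'⟩ := aux l hl
  have hodd : ∀ a q : ℤ, a + 1 = i + q * E.n → (Even a ↔ ¬ Even i) := by
    intro a q h
    have h1 := E.even_add_mul_n i q
    rw [← h, Int.even_add_one] at h1
    tauto
  have heven : ∀ a q : ℤ, a = i + q * E.n → (Even a ↔ Even i) := by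
    rintro a q rfl
    exact E.even_add_mul_n i q
  apply hne
  rcases hq with hq | hq <;> rcases hq' with hq' | hq'
  · exact key k l q q' hk0 hkn hl0 hln (by rw [sub_mul]; linarith)
  · have h1 := heven _ _ hq
    have h2 := hodd _ _ hq'
    tauto
  · have h1 := hodd _ _ hq
    have h2 := heven _ _ hq'
    tauto
  · exact key k l q q' hk0 hkn hl0 hln (by rw [sub_mul]; linarith)

/-- Otherwise there are nested coincidences `s, j` and `s + 1, l`. The edge `s` is then traversed
once, and the edges `j - 1` and `l`, both of its parity, lie in its cyclic block. They make both
ends of the edge `s` sinks. -/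
theorem IsCactus.single_of_hasNoAdjacentSinks (h : E.IsCactus) (hs : E.HasNoAdjacentSinks)
    {s j : ℤ} (hsj : s < j) (hj : j < s + E.n) (hv : E.v s = E.v j)
    (hne : E.ed s ≠ E.ed (j - 1)) : E.Single (s + 1) := by
  by_contra hsing
  obtain ⟨l, hsl, hlj, hv'⟩ := h.nested hsj hj hv hne hsing
  have hodd1 := h.odd s j hsj hj hv
  have hodd2 := h.odd (s + 1) l hsl (by omega) hv'
  rw [Int.odd_iff] at hodd1 hodd2
  obtain ⟨C, hblock, hcyc, hadj, hall⟩ := h.exists_cyclic_block (i := s) (by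
    intro k h1 h2 he
    have he' := congrArg Subtype.val he
    rw [coe_ed, coe_ed, Sym2.eq_iff] at he'
    rcases he' with ⟨h3, h4⟩ | ⟨h3, h4⟩
    · by_cases hkj : k = j
      · subst hkj
        have h5 := h.le_three hsj hj hv
        exact h.ne_of_lt (k := k + 1) hsl (by omega) hv' (by omega) (by omega) (by omega) h4
      · exact h.ne_of_lt hsj hj hv h1 h2 hkj h3
    · by_cases hkl : k = l
      · subst hkl
        exact h.ne_of_lt (k := k + 1) hsj hj hv (by omega) (by omega) (by omega) h4
      · by_cases hks : k = s + 1
        · subst hks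
          exact h.ne_of_lt (k := s + 1 + 1) hsj hj hv (by omega) (by omega) (by omega) h4
        · exact h.ne_of_lt (k := k) hsl (by omega) hv' (by omega) (by omega) hkl h3)
  have hsep1 : ¬ E.Sep s (j - 1) := by
    rintro ⟨t, m, h1, h2, h3, h4, h5⟩
    rcases (by omega : m = j ∨ m = s + E.n ∨ (j < m ∧ m < s + E.n)) with rfl | rfl | ⟨h6, h7⟩
    · exact h.ne_of_lt (k := t) hsj hj hv h1 (by omega) (by omega) (h5.trans hv.symm)
    · exact h.ne_of_lt (k := t) hsj hj hv h1 (by omega) (by omega) (h5.trans (E.v_add_n s))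
    · exact h.noncross s t j m h1 (by omega) h6 h7 hv h5
  have hsep2 : ¬ E.Sep s l := by
    rintro ⟨t, m, h1, h2, h3, h4, h5⟩
    rcases (by omega : t = s + 1 ∨ t = l ∨ (s + 1 < t ∧ t < l)) with rfl | rfl | ⟨h6, h7⟩
    · exact h.ne_of_lt (k := m) hsl (by omega) hv' (by omega) (by omega) (by omega) h5.symm
    · exact h.ne_of_lt (k := m) hsl (by omega) hv' (by omega) (by omega) (by omega)
        (h5.symm.trans hv'.symm)
    · exact h.noncross (s + 1) t l m h6 h7 h3 (by omega) hv' h5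
  have hadj1 := hall (j - 1) (by omega) (by omega) hsep1
  have hadj2 := hall l (by omega) (by omega) hsep2
  refine hs C hblock hcyc (E.v s) (E.v (s + 1)) ?_ ?_ hadj
  · refine isSinkOf_of_lt (i := s) (j := j - 1) (by omega) (by omega)
      (Int.even_iff.2 (by omega)) hadj hadj1 (E.mem_ed_left s) ?_
    rw [hv]
    exact E.mem_ed_pred j
  · refine isSinkOf_of_lt (i := s) (j := l) (by omega) (by omega)
      (Int.even_iff.2 (by omega)) hadj hadj2 (E.mem_ed_right s) ?_
    rw [hv']
    exact E.mem_ed_left l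

/-- Sinks are visited twice, so by the sink condition an edge joining two of them is traversed back
and forth, and `not_cyclic` excludes its block. -/
theorem IsRigid.hasNoAdjacentSinks (h : E.IsRigid) : E.HasNoAdjacentSinks := by
  intro B hB hc a b ha hb hab
  have key : ∀ i, E.IsSinkOf B (E.v i) → E.IsSinkOf B (E.v (i + 1)) →
      B.Adj (E.v i) (E.v (i + 1)) → False := by
    intro i h1 h2 h3
    obtain ⟨j, hij, hj, hv⟩ := (not_single_iff E).1 h1.not_single
    have he : E.ed i = E.ed (j - 1) := by
      by_contra he
      exact h2.not_single (h.sink i j hij hj hv he)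
    have he' := congrArg Subtype.val he
    rw [coe_ed, coe_ed, sub_add_cancel, hv, Sym2.eq_swap, Sym2.congr_left] at he'
    exact h.not_cyclic hij hj hv he' hB.prop.1 hB.prop.2 hc h3
  obtain ⟨i, hi⟩ := hB.prop.1.2 hab
  rcases Sym2.eq_iff.1 hi with ⟨rfl, rfl⟩ | ⟨rfl, rfl⟩
  · exact key i ha hb hab
  · exact key i hb ha hab.symm

/-! ### Bridges -/

/-- The ends of the edge lie in two different blocks. -/
def IsBridgeEdge (E : EvenCircuit G) (e : Sym2 V) : Prop :=
  ∃ B₁ B₂ : G.Subgraph, IsBlock E.sub B₁ ∧ IsBlock E.sub B₂ ∧ B₁ ≠ B₂ ∧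
    ∃ a ∈ B₁.verts, ∃ b ∈ B₂.verts, e = s(a, b)

theorem sub_adj (E : EvenCircuit G) (i : ℤ) : E.sub.Adj (E.v i) (E.v (i + 1)) := ⟨i, rfl⟩

/-- A vertex visited twice lies in two blocks, one inside and one outside of its coincidence. At
least one of them differs from a given block at the other end. -/
theorem IsCactus.single_of_not_bridge [Finite V] (h : E.IsCactus) {s j : ℤ}
    (hb : ¬ E.IsBridgeEdge s(E.v s, E.v j)) : E.Single s := by
  by_contra hs
  obtain ⟨k, h1, h2, h3⟩ := (not_single_iff E).1 hs
  have h4 := h.three_le h1 h2 h3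
  have h5 := h.le_three h1 h2 h3
  obtain ⟨B, hB, hB'⟩ := exists_isBlock_adj (E.sub_adj s)
  obtain ⟨B₁, hB₁, hB₁'⟩ := exists_isBlock_adj (E.sub_adj (s + E.n - 1))
  obtain ⟨B₂, hB₂, hB₂'⟩ := exists_isBlock_adj (E.sub_adj j)
  rw [sub_add_cancel, E.v_add_n] at hB₁'
  have hne : B ≠ B₁ := by
    rintro rfl
    exact h.one_side hB.prop.1 hB.prop.2 h1 h2 h3 (k := s + 1) (l := s + E.n - 1) (by omega)
      (by omega) (by omega) (by omega) hB'.snd_mem hB₁'.fst_mem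
  by_cases h6 : B = B₂
  · exact hb ⟨B₁, B₂, hB₁, hB₂, fun h7 => hne (h6.trans h7.symm), _, hB₁'.snd_mem, _,
      hB₂'.fst_mem, rfl⟩
  · exact hb ⟨B, B₂, hB, hB₂, h6, _, hB'.fst_mem, _, hB₂'.fst_mem, rfl⟩

theorem IsCactus.not_sep_of_not_bridge [Finite V] (h : E.IsCactus) {s j k l : ℤ}
    (hb : ¬ E.IsBridgeEdge s(E.v s, E.v j)) (hks : k < s) (hsl : s < l) (hlj : l < j)
    (hj : j < k + E.n) : E.v k ≠ E.v l := by
  intro hv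
  obtain ⟨B₁, hB₁, hB₁'⟩ := exists_isBlock_adj (E.sub_adj s)
  obtain ⟨B₂, hB₂, hB₂'⟩ := exists_isBlock_adj (E.sub_adj j)
  refine hb ⟨B₁, B₂, hB₁, hB₂, ?_, _, hB₁'.fst_mem, _, hB₂'.fst_mem, rfl⟩
  rintro rfl
  exact h.one_side hB₁.prop.1 hB₁.prop.2 (by omega) (by omega) hv hks hsl hlj hj hB₁'.fst_mem
    hB₂'.fst_mem

/-- Both ends of the chord are visited once and no coincidence separates them, so the edges `s` and
`j` share a cyclic block `C`. It is the only block through either end. -/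
theorem IsRigid.not_bridge (h : E.IsRigid) {e : G.edgeSet} (he : E.IsChordEdge e) :
    ¬ E.IsBridgeEdge e := by
  rintro ⟨B₁, B₂, hB₁, hB₂, hne, a, ha, b, hb, hab⟩
  obtain ⟨s, rfl⟩ := he.2 a (by rw [hab]; exact Sym2.mem_mk_left _ _)
  obtain ⟨j', rfl⟩ := he.2 b (by rw [hab]; exact Sym2.mem_mk_right _ _)
  obtain ⟨q, h1, h2⟩ := E.exists_rep s j'
  rw [← E.v_add_mul_n j' q] at hb hab
  obtain ⟨j, hj⟩ : ∃ j, j = j' + q * E.n := ⟨_, rfl⟩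
  rw [← hj] at h1 h2 hb hab
  have hsj : s < j := by
    refine lt_of_le_of_ne h1 ?_
    rintro rfl
    have := e.2
    rw [hab] at this
    exact G.irrefl this
  have hss := h.chord_single e s j he hab
  have hsj' := h.single_right he hab
  have hsep : ∀ t m, s < t → t < j → j < m → m < s + E.n → E.v t ≠ E.v m := fun t m h3 h4 h5 h6 =>
    h.chord_sep e j (s + E.n) he (by rw [hab, E.v_add_n, Sym2.eq_swap]) t m h4 h5 h6 (by omega)
  have hsingj : ∀ t, s < t → t < s + E.n → t ≠ j → E.v t ≠ E.v j := by
    intro t h3 h4 h5 h6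
    rcases lt_or_gt_of_ne h5 with h5 | h5
    · exact hsj' (t + E.n) (by omega) (by omega) (by rw [E.v_add_n, h6])
    · exact hsj' t h5 (by omega) h6
  obtain ⟨C, hblock, -, hadj, hall⟩ := h.exists_cyclic_block (i := s) (by
    intro k h3 h4 h5
    have h6 : E.v s ∈ (E.ed k : Sym2 V) := by rw [h5]; exact E.mem_ed_left s
    rcases mem_ed_iff.1 h6 with h6 | h6
    · exact hss k h3 h4 h6.symm
    · by_cases h7 : k + 1 = s + E.n
      · refine h.ed_pred_ne s ?_
        rw [← h5, ← E.ed_add_n (s - 1)]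
        congr 1
        linarith
      · exact hss (k + 1) (by omega) (by omega) h6.symm)
  have hCj : C.Adj (E.v j) (E.v (j + 1)) := by
    refine hall j hsj h2 ?_
    rintro ⟨t, m, h3, h4, h5, h6, h7⟩
    rcases h6.eq_or_lt with rfl | h6
    · rw [E.v_add_n] at h7
      exact hss t h3 (by omega) h7
    rcases h4.eq_or_lt with rfl | h4
    · exact hsingj m (by omega) h6 (by omega) h7.symm
    · exact hsep t m h3 h4 h5 h6 h7
  -- A block through an end of the chord has no edge separated from `s`: the separating coincidence
  -- would have that end strictly on its other side. Hence the block is contained in `C`, and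
  -- maximality gives equality.
  have key : ∀ B : G.Subgraph, IsBlock E.sub B → (E.v s ∈ B.verts ∨ E.v j ∈ B.verts) →
      B = C := by
    intro B hB hmem
    have hle : B ≤ C := by
      have hsepB : ∀ k, s < k → k < s + E.n → B.Adj (E.v k) (E.v (k + 1)) → ¬ E.Sep s k := by
        rintro k h3 h4 h5 ⟨t, m, h6, h7, h8, h9, h10⟩
        have h11 := h.three_le (s := t) (j := m) (by omega) (by omega) h10
        obtain ⟨k', hk1, hk2, hk'⟩ : ∃ k', t < k' ∧ k' < m ∧ E.v k' ∈ B.verts := by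
          by_cases h7 : t < k
          · exact ⟨k, h7, h8, h5.fst_mem⟩
          · exact ⟨k + 1, by omega, by omega, h5.snd_mem⟩
        have h9' : m ≠ s + E.n := by
          rintro rfl
          rw [E.v_add_n] at h10
          exact hss t h6 (by omega) h10
        rcases hmem with hmem | hmem
        · exact h.one_side hB.prop.1 hB.prop.2 (by omega) (by omega) h10 hk1 hk2
            (l := s + E.n) (by omega) (by omega) hk' (by rwa [E.v_add_n])
        · have ht : t ≠ j := by
            rintro rfl
            exact hsingj m (by omega) (by omega) (by omega) h10.symm
          have hm : m ≠ j := by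
            rintro rfl
            exact hsingj t (by omega) (by omega) (by omega) h10
          by_cases h12 : t < j ∧ j < m
          · exact hsep t m h6 h12.1 h12.2 (by omega) h10
          · obtain ⟨l, hl1, hl2, hl3⟩ : ∃ l, m < l ∧ l < t + E.n ∧ E.v l = E.v j := by
              by_cases h13 : j < t
              · exact ⟨j + E.n, by omega, by omega, E.v_add_n j⟩
              · exact ⟨j, by omega, by omega, rfl⟩
            exact h.one_side hB.prop.1 hB.prop.2 (by omega) (by omega) h10 hk1 hk2
              hl1 hl2 hk' (by rwa [hl3])
      rcases hmem with hmem | hmem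
      · exact le_of_not_sep hB.prop.1 hB.prop.2 hadj hall hsepB hmem hadj.fst_mem
      · exact le_of_not_sep hB.prop.1 hB.prop.2 hadj hall hsepB hmem hCj.fst_mem
    exact le_antisymm hle (hB.2 hblock.prop hle)
  exact hne ((key B₁ hB₁ (Or.inl ha)).trans (key B₂ hB₂ (Or.inr hb)).symm)

end EvenCircuit

section WalkExponents

variable {V : Type*} {G : SimpleGraph V}

/-! ### Exponent vectors of walks -/

theorem expPlus_cons {a b c : V} (h : G.Adj a b) (p : G.Walk b c) :
    expPlus (Walk.cons h p) = Finsupp.single ⟨s(a, b), G.mem_edgeSet.2 h⟩ 1 + expMinus p := by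
  refine (Fin.sum_univ_succ (n := p.length) _).trans ?_
  congr 1
  · rw [if_pos (by exact Even.zero)]
    congr 1
    exact Subtype.ext (by simp [edgeAt])
  · refine Finset.sum_congr rfl fun i _ => ?_
    have : Even ((i.succ : Fin (p.length + 1)) : ℕ) ↔ Odd (i : ℕ) := by
      rw [Fin.val_succ, Nat.even_add_one, Nat.not_even_iff_odd]
    simp only [this]
    rfl

theorem expMinus_cons {a b c : V} (h : G.Adj a b) (p : G.Walk b c) :
    expMinus (Walk.cons h p) = expPlus p := by
  refine (Fin.sum_univ_succ (n := p.length) _).trans ?_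
  rw [if_neg (by exact Nat.not_odd_zero), zero_add]
  refine Finset.sum_congr rfl fun i _ => ?_
  have : Odd ((i.succ : Fin (p.length + 1)) : ℕ) ↔ Even (i : ℕ) := by
    rw [Fin.val_succ, Nat.odd_add_one, Nat.not_odd_iff_even]
  simp only [this]
  rfl

theorem expPlus_nil (a : V) : expPlus (Walk.nil : G.Walk a a) = 0 := rfl

theorem expMinus_nil (a : V) : expMinus (Walk.nil : G.Walk a a) = 0 := rfl

theorem degree_expPlus_add {a b : V} (p : G.Walk a b) :
    (expPlus p).degree + (expMinus p).degree = p.length := by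
  induction p with
  | nil => simp [expPlus_nil, expMinus_nil]
  | cons h p ih =>
    rw [expPlus_cons, expMinus_cons, map_add, Finsupp.degree_single, Walk.length_cons]
    omega

theorem aDegree_expPlus_sub {a b : V} (p : G.Walk a b) :
    aDegree edgeVector (expPlus p) - aDegree edgeVector (expMinus p) =
      Finsupp.single a (1 : ℤ) - sgn p.length • Finsupp.single b 1 := by
  induction p with
  | nil =>
    rw [expPlus_nil, expMinus_nil, sub_self, Walk.length_nil, Nat.cast_zero,
      sgn_of_even Even.zero, one_smul, sub_self]
  | @cons a b' c h p ih =>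
    rw [expPlus_cons, expMinus_cons, aDegree_add, aDegree_single, one_smul,
      EvenCircuit.edgeVector_mk, Walk.length_cons, Nat.cast_succ, sgn_add_one, neg_smul,
      sub_neg_eq_add, add_sub_assoc, ← neg_sub (aDegree edgeVector (expPlus p)), ih]
    abel

theorem degree_mono_of_le {σ : Type*} {u v : σ →₀ ℕ} (h : u ≤ v) : u.degree ≤ v.degree := by
  obtain ⟨r, rfl⟩ := le_iff_exists_add.1 h
  rw [map_add]
  omega

theorem edgeVector_apply_eq_zero {e : G.edgeSet} {p : V} (h : p ∉ (e : Sym2 V)) :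
    edgeVector e p = 0 := by
  obtain ⟨e, he⟩ := e
  induction e with
  | h x y =>
    rw [Sym2.mem_iff, not_or] at h
    rw [EvenCircuit.edgeVector_mk]
    simp [h.1, h.2]

theorem aDegree_apply_nonneg (c : G.edgeSet →₀ ℕ) (p : V) : 0 ≤ aDegree edgeVector c p := by
  rw [aDegree, Finsupp.sum, Finsupp.finsetSum_apply]
  refine Finset.sum_nonneg fun e _ => ?_
  obtain ⟨e, he⟩ := e
  induction e with
  | h x y =>
    classical
    rw [EvenCircuit.edgeVector_mk, Finsupp.smul_apply, Finsupp.add_apply, Finsupp.single_apply,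
      Finsupp.single_apply]
    split_ifs <;> simp

theorem exists_mem_of_aDegree_pos {c : G.edgeSet →₀ ℕ} {p : V}
    (h : 0 < aDegree edgeVector c p) : ∃ e : G.edgeSet, 0 < c e ∧ p ∈ (e : Sym2 V) := by
  by_contra hcon
  push Not at hcon
  rw [aDegree, Finsupp.sum, Finsupp.finsetSum_apply, Finset.sum_eq_zero] at h
  · exact lt_irrefl _ h
  · intro e he
    rw [Finsupp.smul_apply, edgeVector_apply_eq_zero
      (hcon e (Nat.pos_of_ne_zero (Finsupp.mem_support_iff.1 he))), smul_zero]

/-- A walk whose edges are taken alternately from `A` and `B`, two exponent vectors of the same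
degree, extends to a closed one. -/
theorem exists_closed_of_walk (N : ℕ) : ∀ (A B : G.edgeSet →₀ ℕ),
    aDegree edgeVector A = aDegree edgeVector B → ∀ (z y : V) (ξ : G.Walk z y), 0 < ξ.length →
    expPlus ξ ≤ A → expMinus ξ ≤ B → A.degree + B.degree < ξ.length + N →
    ∃ (x : V) (η : G.Walk x x), Even η.length ∧ 0 < η.length ∧
      ((Even ξ.length ∧ expPlus η ≤ A ∧ expMinus η ≤ B) ∨
        (Odd ξ.length ∧ expPlus η ≤ B ∧ expMinus η ≤ A)) := by
  classical
  induction N with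
  | zero =>
    intro A B _ z y ξ _ hA hB hlt
    have := degree_expPlus_add ξ
    have := degree_mono_of_le hA
    have := degree_mono_of_le hB
    omega
  | succ N ih =>
    intro A B hAB z y ξ hpos hA hB hlt
    by_cases hdone : Even ξ.length ∧ z = y
    · obtain ⟨hev, rfl⟩ := hdone
      exact ⟨z, ξ, hev, hpos, Or.inl ⟨hev, hA, hB⟩⟩
    obtain ⟨r, hr⟩ := le_iff_exists_add.1 hA
    obtain ⟨t, ht⟩ := le_iff_exists_add.1 hB
    have hdeg := aDegree_expPlus_sub ξ
    -- The degree of what is left of `B` at the start `z` is that of what is left of `A`, plus 1,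
    -- minus the signed contribution of `y`. The latter cancels the 1 only when the walk is already
    -- closed and even.
    have ht0 : 0 < aDegree edgeVector t z := by
      have h1 : aDegree edgeVector t = aDegree edgeVector r +
          (aDegree edgeVector (expPlus ξ) - aDegree edgeVector (expMinus ξ)) := by
        rw [hr, ht, aDegree_add, aDegree_add] at hAB
        rw [← add_sub_assoc, eq_sub_iff_add_eq', ← hAB, add_comm]
      rw [h1, hdeg, Finsupp.add_apply, Finsupp.sub_apply, Finsupp.smul_apply,
        Finsupp.single_eq_same, Finsupp.single_apply]
      have h2 := aDegree_apply_nonneg r z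
      rcases Nat.even_or_odd ξ.length with h | h
      · rw [if_neg (fun h3 => hdone ⟨h, h3.symm⟩), smul_zero]
        omega
      · rw [sgn_of_odd (by exact_mod_cast h)]
        split_ifs <;> simp <;> omega
    obtain ⟨e, he, hze⟩ := exists_mem_of_aDegree_pos ht0
    obtain ⟨z', hz', hadj⟩ := EvenCircuit.exists_mk_eq hze
    have he' : e = ⟨s(z', z), G.mem_edgeSet.2 hadj.symm⟩ :=
      Subtype.ext (by rw [hz', Sym2.eq_swap])
    -- Prepending an edge shifts all positions by one, so `A` and `B` exchange roles. The total
    -- degree bounds the number of such steps.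
    obtain ⟨x, η, h1, h2, h3⟩ := ih B A hAB.symm z' y (Walk.cons hadj.symm ξ) (by simp)
      (by
        rw [expPlus_cons, ht, add_comm, ← he']
        exact add_le_add_right (Finsupp.single_le_iff.2 he) _)
      (by rw [expMinus_cons]; exact hA)
      (by rw [Walk.length_cons]; omega)
    refine ⟨x, η, h1, h2, ?_⟩
    rw [Walk.length_cons, Nat.even_add_one, Nat.odd_add_one, Nat.not_even_iff_odd,
      Nat.not_odd_iff_even] at h3
    exact h3.symm

/-- Two nonzero exponent vectors of the same degree contain an even closed walk. -/
theorem exists_closed_walk {A B : G.edgeSet →₀ ℕ}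
    (hAB : aDegree edgeVector A = aDegree edgeVector B) {e : G.edgeSet} (he : 0 < B e) :
    ∃ (x : V) (η : G.Walk x x), Even η.length ∧ 0 < η.length ∧ expPlus η ≤ A ∧
      expMinus η ≤ B := by
  obtain ⟨⟨a, b⟩, hab⟩ := Quot.exists_rep (e : Sym2 V)
  have hadj : G.Adj a b := by
    rw [← SimpleGraph.mem_edgeSet]
    exact (show s(a, b) = e from hab) ▸ e.2
  have he' : e = ⟨s(a, b), G.mem_edgeSet.2 hadj⟩ := Subtype.ext hab.symm
  obtain ⟨x, η, h1, h2, h3⟩ := exists_closed_of_walk (B.degree + A.degree) B A hAB.symm a b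
    (Walk.cons hadj Walk.nil) (by simp)
    (by
      rw [expPlus_cons, expMinus_nil, add_zero, ← he']
      exact Finsupp.single_le_iff.2 he)
    (by rw [expMinus_cons, expPlus_nil]; exact zero_le)
    (by simp)
  refine ⟨x, η, h1, h2, ?_⟩
  rcases h3 with h3 | h3
  · simp at h3
  · exact h3.2

end WalkExponents

/-! ### The circuit of an even closed walk -/

section OfWalk

variable {V : Type*} {G : SimpleGraph V} {x : V} (w : G.Walk x x)

theorem sum_Ico_intCast {A : Type*} [AddCommMonoid A] (n : ℕ) (f : ℤ → A) :
    ∑ i ∈ Finset.Ico (0 : ℤ) n, f i = ∑ i : Fin n, f ((i : ℕ) : ℤ) := by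
  symm
  refine Finset.sum_nbij (fun i : Fin n => ((i : ℕ) : ℤ)) ?_ ?_ ?_ (fun _ _ => rfl)
  · intro i _
    simp
  · intro i _ j _ hij
    have h : ((i : ℕ) : ℤ) = (j : ℕ) := hij
    exact Fin.ext (by exact_mod_cast h)
  · intro i hi
    rw [Finset.coe_Ico, Set.mem_Ico] at hi
    exact ⟨⟨i.toNat, by omega⟩, by simp, by simp [hi.1]⟩

/-- The periodic sequence of the vertices of a closed walk. -/
def circuitVert (i : ℤ) : V := w.getVert (i % w.length).toNat

theorem circuitVert_natCast {k : ℕ} (hk : k ≤ w.length) : circuitVert w k = w.getVert k := by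
  rw [circuitVert]
  rcases hk.eq_or_lt with rfl | hk
  · rw [Int.emod_self, Int.toNat_zero, Walk.getVert_zero, Walk.getVert_length]
  · rw [Int.emod_eq_of_lt (by omega) (by omega), Int.toNat_natCast]

theorem circuitVert_add (i : ℤ) : circuitVert w (i + w.length) = circuitVert w i := by
  rw [circuitVert, circuitVert, Int.add_emod_right]

theorem exists_circuitVert_eq (hpos : 0 < w.length) (i : ℤ) : ∃ k < w.length,
    circuitVert w i = w.getVert k ∧ circuitVert w (i + 1) = w.getVert (k + 1) := by
  have h1 := Int.emod_nonneg i (b := w.length) (by omega)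
  have h2 := Int.emod_lt_of_pos i (b := w.length) (by omega)
  refine ⟨(i % w.length).toNat, by omega, rfl, ?_⟩
  rw [← circuitVert_natCast w (by omega : (i % w.length).toNat + 1 ≤ w.length), circuitVert,
    circuitVert]
  congr 2
  push_cast
  rw [Int.toNat_of_nonneg h1, Int.emod_add_emod]

/-- The circuit of an even closed walk. -/
def circuit (hw : Even w.length) (hpos : 0 < w.length) : EvenCircuit G where
  n := w.length
  n_pos := by exact_mod_cast hpos
  even_n := by exact_mod_cast hw
  v := circuitVert w
  v_add_n := circuitVert_add w
  adj i := by
    obtain ⟨k, hk, h1, h2⟩ := exists_circuitVert_eq w hpos i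
    rw [h1, h2]
    exact w.adj_getVert_succ hk

variable (hw : Even w.length) (hpos : 0 < w.length)

theorem circuit_n : (circuit w hw hpos).n = w.length := rfl

theorem circuit_v {k : ℕ} (hk : k ≤ w.length) : (circuit w hw hpos).v k = w.getVert k :=
  circuitVert_natCast w hk

theorem circuit_ed (i : Fin w.length) : (circuit w hw hpos).ed (i : ℕ) = edgeAt w i := by
  apply Subtype.ext
  have h := circuit_v w hw hpos (k := i + 1) i.isLt
  push_cast at h
  rw [EvenCircuit.coe_ed, circuit_v w hw hpos i.isLt.le, h]
  rfl

theorem circuit_plus : (circuit w hw hpos).plus = expPlus w := by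
  rw [EvenCircuit.plus, EvenCircuit.part, Finset.sum_filter, circuit_n, sum_Ico_intCast, expPlus]
  refine Finset.sum_congr rfl fun i _ => ?_
  rw [circuit_ed]
  simp only [Int.even_coe_nat]

theorem circuit_minus : (circuit w hw hpos).minus = expMinus w := by
  rw [EvenCircuit.minus, EvenCircuit.part, Finset.sum_filter, circuit_n, sum_Ico_intCast, expMinus]
  refine Finset.sum_congr rfl fun i _ => ?_
  rw [circuit_ed]
  simp only [Int.odd_coe_nat]

theorem mem_support_iff_circuit {p : V} : p ∈ w.support ↔ ∃ i, (circuit w hw hpos).v i = p := by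
  rw [Walk.mem_support_iff_exists_getVert]
  constructor
  · rintro ⟨k, rfl, hk⟩
    exact ⟨k, circuit_v w hw hpos hk⟩
  · rintro ⟨i, rfl⟩
    obtain ⟨k, hk, h1, -⟩ := exists_circuitVert_eq w hpos i
    exact ⟨k, h1.symm, hk.le⟩

theorem toSubgraph_adj_iff_circuit {a b : V} :
    w.toSubgraph.Adj a b ↔ (circuit w hw hpos).sub.Adj a b := by
  rw [Walk.toSubgraph_adj_iff]
  constructor
  · rintro ⟨k, h, hk⟩
    refine ⟨k, ?_⟩
    have h' := circuit_v w hw hpos (k := k + 1) hk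
    push_cast at h'
    rw [circuit_v w hw hpos hk.le, h', h]
  · rintro ⟨i, hi⟩
    obtain ⟨k, hk, h1, h2⟩ := exists_circuitVert_eq w hpos i
    refine ⟨k, ?_, hk⟩
    rw [← h1, ← h2]
    exact hi.symm

theorem circuit_sub : (circuit w hw hpos).sub = w.toSubgraph := by
  ext a b
  · rw [Walk.mem_verts_toSubgraph, mem_support_iff_circuit w hw hpos]
    rfl
  · exact (toSubgraph_adj_iff_circuit w hw hpos).symm

theorem isChord_iff (e : G.edgeSet) : IsChord w e ↔ (circuit w hw hpos).IsChordEdge e := by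
  have h1 : (e : Sym2 V) ∈ w.edges ↔ ∃ i, e = (circuit w hw hpos).ed i := by
    obtain ⟨e, he⟩ := e
    induction e with
    | h a b =>
      rw [← Walk.mem_edges_toSubgraph, Subgraph.mem_edgeSet, ← circuit_sub w hw hpos]
      exact exists_congr fun i =>
        ⟨fun h => Subtype.ext h, fun h => congrArg Subtype.val h⟩
  rw [IsChord, h1, EvenCircuit.IsChordEdge, not_exists]
  simp only [mem_support_iff_circuit w hw hpos]
  have := e.2
  tauto

theorem isWalkBridge_iff (e : G.edgeSet) :
    IsWalkBridge w e ↔ IsChord w e ∧ (circuit w hw hpos).IsBridgeEdge e := by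
  rw [IsWalkBridge, EvenCircuit.IsBridgeEdge, circuit_sub]

theorem isSink_iff (B : G.Subgraph) (p : V) :
    IsSink w B p ↔ (circuit w hw hpos).IsSinkOf B p := by
  constructor
  · rintro ⟨i, j, hne, hpar, hi, hj, hpi, hpj⟩
    refine ⟨(i : ℕ), (j : ℕ), by omega, ?_, by omega, ?_, ?_, ?_, ?_, ?_, ?_, ?_⟩
    · rw [circuit_n]; exact_mod_cast i.isLt
    · rw [circuit_n]; exact_mod_cast j.isLt
    · exact fun h => hne (Fin.ext (by exact_mod_cast h))
    · simpa only [Int.even_coe_nat] using hpar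
    all_goals rwa [circuit_ed]
  · rintro ⟨i, j, hi0, hin, hj0, hjn, hne, hpar, hi, hj, hpi, hpj⟩
    lift i to ℕ using hi0
    lift j to ℕ using hj0
    rw [circuit_n] at hin hjn
    have e1 := circuit_ed w hw hpos ⟨i, by exact_mod_cast hin⟩
    have e2 := circuit_ed w hw hpos ⟨j, by exact_mod_cast hjn⟩
    simp only at e1 e2
    rw [e1] at hi hpi
    rw [e2] at hj hpj
    refine ⟨⟨i, by exact_mod_cast hin⟩, ⟨j, by exact_mod_cast hjn⟩, ?_, ?_, hi, hj, hpi, hpj⟩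
    · intro h
      exact hne (by rw [Fin.mk.injEq] at h; rw [h])
    · simpa only [Int.even_coe_nat] using hpar

theorem isStronglyPrimitive_iff : IsStronglyPrimitive w ↔
    IsPrimitive w ∧ (circuit w hw hpos).HasNoAdjacentSinks := by
  simp only [IsStronglyPrimitive, EvenCircuit.HasNoAdjacentSinks, circuit_sub,
    isSink_iff w hw hpos]

end OfWalk

/-! ### Primitive walks and the characterization -/

section Main

variable {V : Type*} {G : SimpleGraph V} {x : V} (w : G.Walk x x) (hw : Even w.length)
  (hpos : 0 < w.length)

theorem degree_part (E : EvenCircuit G) (S : Finset ℤ) : (E.part S).degree = S.card := by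
  rw [EvenCircuit.part, map_sum]
  simp

/-- A primitive walk has no proper alternating balanced set of indices. -/
theorem IsPrimitive.altDegree_ne_zero {w : G.Walk x x} (hw : Even w.length) (hpos : 0 < w.length)
    (hp : IsPrimitive w) {S : Finset ℤ} {t k : ℤ}
    (hS : S ⊆ Finset.Ico t (t + w.length)) (hk : k ∈ Finset.Ico t (t + w.length)) (hkS : k ∉ S)
    {l : ℤ} (hl : l ∈ S) (hodd : Odd l) : (circuit w hw hpos).altDegree S ≠ 0 := by
  intro h0
  have hdeg := (circuit w hw hpos).aDegree_sub_eq_altDegree S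
  rw [h0, sub_eq_zero] at hdeg
  -- The even and odd edges of `S` have the same degree and so contain an even closed walk. Its
  -- length is at most the size of `S`, which misses the index `k` of the period.
  obtain ⟨y, ξ, h1, h2, h3, h4⟩ := exists_closed_walk hdeg
    (e := (circuit w hw hpos).ed l)
    ((EvenCircuit.part_pos_iff _).2 ⟨l, Finset.mem_filter.2 ⟨hl, hodd⟩, rfl⟩)
  refine hp ⟨y, ξ, h1, h2, ?_, ?_, ?_⟩
  · have h5 := degree_expPlus_add ξ
    have h6 := degree_mono_of_le h3
    have h7 := degree_mono_of_le h4
    rw [degree_part] at h6 h7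
    have h8 : (S.filter Even).card + (S.filter Odd).card = S.card := by
      simp only [← Int.not_even_iff_odd]
      exact Finset.card_filter_add_card_filter_not _
    have h9 : S.card < (Finset.Ico t (t + w.length)).card :=
      Finset.card_lt_card ⟨hS, fun h => hkS (h hk)⟩
    rw [Int.card_Ico] at h9
    omega
  · refine h3.trans ?_
    rw [← circuit_plus w hw hpos, (circuit w hw hpos).plus_eq t]
    exact (circuit w hw hpos).part_mono (Finset.filter_subset_filter _ hS)
  · refine h4.trans ?_
    rw [← circuit_minus w hw hpos, (circuit w hw hpos).minus_eq t]
    exact (circuit w hw hpos).part_mono (Finset.filter_subset_filter _ hS)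

/-- An even gap makes one interval balanced, and two crossing odd gaps make the union of two
alternate arcs balanced. Length 2 is a single edge walked back and forth, with `E⁺ = E⁻`. -/
theorem IsPrimitive.isCactus {w : G.Walk x x} (hw : Even w.length) (hpos : 0 < w.length)
    (hp : IsPrimitive w) (hne : expPlus w ≠ expMinus w) : (circuit w hw hpos).IsCactus := by
  have hodd : ∀ s j, s < j → j < s + (circuit w hw hpos).n →
      (circuit w hw hpos).v s = (circuit w hw hpos).v j → Odd (j - s) := by
    intro s j hsj hj hv
    rw [circuit_n] at hj
    by_contra hev
    rw [Int.not_odd_iff_even] at hev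
    obtain ⟨l, hl1, hl2, hl3⟩ : ∃ l, s ≤ l ∧ l < j ∧ Odd l := by
      rcases Int.even_or_odd s with h | h
      · refine ⟨s + 1, by omega, ?_, h.add_one⟩
        rw [Int.even_iff] at hev
        omega
      · exact ⟨s, le_rfl, hsj, h⟩
    refine hp.altDegree_ne_zero hw hpos (S := Finset.Ico s j) (t := s) (k := j) (l := l)
      (Finset.Ico_subset_Ico le_rfl hj.le) (by simp; omega) (by simp) (by simp; omega) hl3 ?_
    rw [(circuit w hw hpos).altDegree_Ico hsj.le, sgn_eq_of_even_sub hev, hv, sub_self]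
  refine ⟨?_, hodd, ?_⟩
  · rw [circuit_n]
    by_contra hlt
    have h2 : w.length = 2 := by
      rw [Nat.even_iff] at hw
      omega
    apply hne
    have e01 : (circuit w hw hpos).ed 0 = (circuit w hw hpos).ed 1 := by
      apply Subtype.ext
      have hv := (circuit w hw hpos).v_add_n 0
      rw [circuit_n, h2, zero_add, Nat.cast_two] at hv
      rw [EvenCircuit.coe_ed, EvenCircuit.coe_ed, Sym2.eq_swap, zero_add, one_add_one_eq_two, hv]
    rw [← circuit_plus w hw hpos, ← circuit_minus w hw hpos, EvenCircuit.plus, EvenCircuit.minus,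
      EvenCircuit.part, EvenCircuit.part, circuit_n, h2]
    have f0 : (Finset.Ico (0 : ℤ) (2 : ℕ)).filter Even = {0} := by decide
    have f1 : (Finset.Ico (0 : ℤ) (2 : ℕ)).filter Odd = {1} := by decide
    rw [f0, f1, Finset.sum_singleton, Finset.sum_singleton, e01]
  · intro s s' j j' h1 h2 h3 h4 hv hv'
    have o1 := hodd s j (by omega) (by omega) hv
    have o2 := hodd s' j' (by omega) (by omega) hv'
    rw [circuit_n] at h4
    obtain ⟨l, hl1, hl2⟩ : ∃ l, (l = s ∨ l = j) ∧ Odd l := by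
      rcases Int.even_or_odd s with h | h
      · refine ⟨j, Or.inr rfl, ?_⟩
        rw [show j = (j - s) + s by ring]
        exact o1.add_even h
      · exact ⟨s, Or.inl rfl, h⟩
    refine hp.altDegree_ne_zero hw hpos (S := Finset.Ico s s' ∪ Finset.Ico j j') (t := s) (k := s')
      (l := l) ?_ (by simp; omega) (by simp; omega) (by simp; omega) hl2 ?_
    · intro k hk
      simp only [Finset.mem_union, Finset.mem_Ico] at hk ⊢
      omega
    · rw [EvenCircuit.altDegree_union, EvenCircuit.altDegree_Ico _ h1.le,
        EvenCircuit.altDegree_Ico _ h3.le, hv, hv', sgn_eq_neg_of_odd_sub o1,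
        sgn_eq_neg_of_odd_sub o2]
      · simp only [neg_smul]
        abel
      · rw [Finset.disjoint_left]
        intro k hk hk'
        rw [Finset.mem_Ico] at hk hk'
        omega

/-- Replacing `E⁺(ξ)` by `E⁻(ξ)` in `E⁺` stays in the fiber. If the result is `E⁺`, then `E⁺(ξ) =
E⁻(ξ)` divides two coprime monomials and `ξ` is empty. If it is `E⁻`, the cofactor divides both and
is 1, so `ξ` is as long as `w`. -/
theorem EvenCircuit.IsTwoFiber.isPrimitive (hF : (circuit w hw hpos).IsTwoFiber) :
    IsPrimitive w := by
  rintro ⟨y, ξ, h1, h2, h3, h4, h5⟩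
  have hdeg := aDegree_expPlus_sub ξ
  rw [sgn_of_even (by exact_mod_cast h1), one_smul, sub_self, sub_eq_zero] at hdeg
  have hlen := degree_expPlus_add ξ
  obtain ⟨hfib, hdisj⟩ := hF
  rw [circuit_plus, circuit_minus] at hfib hdisj
  obtain ⟨r, hr⟩ := le_iff_exists_add.1 h4
  rcases hfib (r + expMinus ξ) (by rw [hr, aDegree_add, aDegree_add, hdeg, add_comm]) with h | h
  · have h6 : expMinus ξ = expPlus ξ := by
      rw [hr, add_comm] at h
      exact add_right_cancel h
    have h7 : expPlus ξ = 0 := by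
      ext e
      have := hdisj e
      have h8 := h4 e
      have h9 := h5 e
      rw [h6] at h9
      simp only [Finsupp.coe_zero, Pi.zero_apply]
      omega
    rw [h6, h7, map_zero] at hlen
    omega
  · have h6 : r = 0 := by
      ext e
      have := hdisj e
      have h8 := DFunLike.congr_fun hr e
      have h9 := DFunLike.congr_fun h e
      simp only [Finsupp.coe_zero, Pi.zero_apply, Finsupp.add_apply] at *
      omega
    rw [h6, add_zero] at hr
    rw [h6, zero_add] at h
    rw [← hr, h, degree_expPlus_add] at hlen
    omega

theorem isOddChordAt_of {e : G.edgeSet} (he : (circuit w hw hpos).IsChordEdge e)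
    (hb : ¬ (circuit w hw hpos).IsBridgeEdge e) {s j : ℤ} (hs : 0 ≤ s) (hsj : s < j)
    (hj : j < w.length) (hej : (e : Sym2 V) = s((circuit w hw hpos).v s, (circuit w hw hpos).v j))
    (hev : Even (j - s)) : IsOddChordAt w e s.toNat j.toNat := by
  lift s to ℕ using hs
  lift j to ℕ using by omega
  rw [circuit_v w hw hpos (by omega), circuit_v w hw hpos (by omega)] at hej
  refine ⟨(isChord_iff w hw hpos e).2 he, ?_, by omega, by omega, hej, ?_⟩
  · rw [isWalkBridge_iff w hw hpos]
    tauto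
  · simp only [Int.toNat_natCast]
    rw [Int.even_iff] at hev
    rw [Nat.odd_iff]
    omega

/-- The index conditions are cyclic, while effective crossing uses the numbers `0, …, w.length - 1`.
After a shift moving `s` into this range, the four cases record how many of the other three ends
wrap around; a chord with one wrapped end has its ends exchanged. The even length preserves all
parities. -/
theorem crossEffectively_of {e e' : G.edgeSet} (he : (circuit w hw hpos).IsChordEdge e)
    (hb : ¬ (circuit w hw hpos).IsBridgeEdge e) (he' : (circuit w hw hpos).IsChordEdge e')
    (hb' : ¬ (circuit w hw hpos).IsBridgeEdge e') {s j s' j' : ℤ}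
    (hej : (e : Sym2 V) = s((circuit w hw hpos).v s, (circuit w hw hpos).v j))
    (hej' : (e' : Sym2 V) = s((circuit w hw hpos).v s', (circuit w hw hpos).v j'))
    (hev : Even (j - s)) (hev' : Even (j' - s')) (hodd : Odd (s' - s))
    (h1 : s < s') (h2 : s' < j) (h3 : j < j') (h4 : j' < s + w.length) :
    CrossEffectively w e e' := by
  obtain ⟨q, hq1, hq2⟩ := (circuit w hw hpos).exists_rep 0 s
  rw [circuit_n, zero_add] at hq2
  rw [circuit_n] at hq1
  obtain ⟨d, hd⟩ : ∃ d : ℤ, d = q * w.length := ⟨_, rfl⟩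
  have hvd : ∀ i, (circuit w hw hpos).v (i + d) = (circuit w hw hpos).v i := by
    intro i
    rw [hd]
    exact (circuit w hw hpos).v_add_mul_n i q
  have hvd' : ∀ i, (circuit w hw hpos).v (i + d - w.length) = (circuit w hw hpos).v i := by
    intro i
    rw [← hvd i, ← (circuit w hw hpos).v_add_n (i + d - w.length), circuit_n, sub_add_cancel]
  rw [← hd] at hq1 hq2
  have hn : ((w.length : ℕ) : ℤ) % 2 = 0 := by
    rw [Nat.even_iff] at hw
    omega
  have C1 := fun (a b : ℤ) => isOddChordAt_of w hw hpos he hb (s := a) (j := b)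
  have C2 := fun (a b : ℤ) => isOddChordAt_of w hw hpos he' hb' (s := a) (j := b)
  rw [Int.even_iff] at hev hev'
  rw [Int.odd_iff] at hodd
  have hej2 := hej.trans Sym2.eq_swap
  have hej2' := hej'.trans Sym2.eq_swap
  by_cases c1 : j' + d < w.length
  · refine ⟨_, _, _, _,
      C1 (s + d) (j + d) (by omega) (by omega) (by omega) (by rw [hvd, hvd, hej])
        (Int.even_iff.2 (by omega)),
      C2 (s' + d) (j' + d) (by omega) (by omega) (by omega) (by rw [hvd, hvd, hej'])
        (Int.even_iff.2 (by omega)), Int.odd_iff.2 ?_, Or.inl ?_⟩ <;> omega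
  by_cases c2 : j + d < w.length
  · refine ⟨_, _, _, _,
      C1 (s + d) (j + d) (by omega) (by omega) (by omega) (by rw [hvd, hvd, hej])
        (Int.even_iff.2 (by omega)),
      C2 (j' + d - w.length) (s' + d) (by omega) (by omega) (by omega)
        (by rw [hvd, hvd', hej2']) (Int.even_iff.2 (by omega)), Int.odd_iff.2 ?_, Or.inr ?_⟩ <;>
      omega
  by_cases c3 : s' + d < w.length
  · refine ⟨_, _, _, _,
      C1 (j + d - w.length) (s + d) (by omega) (by omega) (by omega)
        (by rw [hvd, hvd', hej2]) (Int.even_iff.2 (by omega)),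
      C2 (j' + d - w.length) (s' + d) (by omega) (by omega) (by omega)
        (by rw [hvd, hvd', hej2']) (Int.even_iff.2 (by omega)), Int.odd_iff.2 ?_, Or.inl ?_⟩ <;>
      omega
  · refine ⟨_, _, _, _,
      C1 (j + d - w.length) (s + d) (by omega) (by omega) (by omega)
        (by rw [hvd, hvd', hej2]) (Int.even_iff.2 (by omega)),
      C2 (s' + d - w.length) (j' + d - w.length) (by omega) (by omega) (by omega)
        (by rw [hvd', hvd', hej']) (Int.even_iff.2 (by omega)), Int.odd_iff.2 ?_, Or.inr ?_⟩ <;>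
      omega

theorem isRigid_of_isStronglyPrimitive [Finite V] (hne : expPlus w ≠ expMinus w)
    (hs : IsStronglyPrimitive w) (hodd : ∀ f : Sym2 V, IsChord w f → IsOddChord w f)
    (hcross : ¬ ∃ f f' : Sym2 V, CrossEffectively w f f') : (circuit w hw hpos).IsRigid := by
  rw [isStronglyPrimitive_iff w hw hpos] at hs
  have hcactus := hs.1.isCactus hw hpos hne
  have hb : ∀ e, (circuit w hw hpos).IsChordEdge e → ¬ (circuit w hw hpos).IsBridgeEdge e := by
    intro e he hbr
    have hch := (isChord_iff w hw hpos e).2 he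
    obtain ⟨s, j, -, h, -⟩ := hodd e hch
    exact h ((isWalkBridge_iff w hw hpos e).2 ⟨hch, hbr⟩)
  have hsing : ∀ e s j, (circuit w hw hpos).IsChordEdge e →
      (e : Sym2 V) = s((circuit w hw hpos).v s, (circuit w hw hpos).v j) →
      (circuit w hw hpos).Single s := fun e s j he hej =>
    hcactus.single_of_not_bridge (hej ▸ hb e he)
  -- An odd chord has even distance for some choice of indices. Its ends are visited once, so other
  -- choices differ by multiples of the even length.
  have heven : ∀ e s j, (circuit w hw hpos).IsChordEdge e →
      (e : Sym2 V) = s((circuit w hw hpos).v s, (circuit w hw hpos).v j) → Even (j - s) := by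
    intro e s j he hej
    obtain ⟨s₀, j₀, -, -, h1, h2, h3, h4⟩ := hodd e ((isChord_iff w hw hpos e).2 he)
    rw [← circuit_v w hw hpos (by omega), ← circuit_v w hw hpos (by omega), hej] at h3
    have hs' := hsing e s j he hej
    have hj' := hsing e j s he (hej.trans Sym2.eq_swap)
    have h5 : Even ((j₀ : ℤ) - s₀) := by
      rw [Nat.odd_iff] at h4
      rw [Int.even_iff]
      omega
    rw [Int.even_sub] at h5 ⊢
    rcases Sym2.eq_iff.1 h3 with ⟨h6, h7⟩ | ⟨h6, h7⟩
    · obtain ⟨q, hq⟩ := hs'.exists_eq h6.symm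
      obtain ⟨q', hq'⟩ := hj'.exists_eq h7.symm
      rw [hq, hq', EvenCircuit.even_add_mul_n, EvenCircuit.even_add_mul_n] at h5
      exact h5
    · obtain ⟨q, hq⟩ := hs'.exists_eq h6.symm
      obtain ⟨q', hq'⟩ := hj'.exists_eq h7.symm
      rw [hq, hq', EvenCircuit.even_add_mul_n, EvenCircuit.even_add_mul_n] at h5
      exact h5.symm
  exact
    { toIsCactus := hcactus
      sink := fun s j h1 h2 h3 h4 => hcactus.single_of_hasNoAdjacentSinks hs.2 h1 h2 h3 h4
      chord_single := hsing
      chord_even := heven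
      chord_sep := fun e s j he hej k l h1 h2 h3 h4 =>
        hcactus.not_sep_of_not_bridge (hej ▸ hb e he) h1 h2 h3 h4
      chord_cross := fun e e' s j s' j' he hej he' hej' h1 h2 h3 h4 h5 =>
        hcross ⟨e, e', crossEffectively_of w hw hpos he (hb e he) he' (hb e' he') hej hej'
          (heven e s j he hej) (heven e' s' j' he' hej') h5 h1 h2 h3 h4⟩ }

theorem EvenCircuit.IsRigid.isOddChord (h : (circuit w hw hpos).IsRigid) {f : Sym2 V}
    (hf : IsChord w f) : IsOddChord w f := by
  obtain ⟨e, rfl⟩ : ∃ e : G.edgeSet, f = e := ⟨⟨f, hf.1⟩, rfl⟩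
  have he := (isChord_iff w hw hpos e).1 hf
  have hb := h.not_bridge he
  obtain ⟨⟨a, b⟩, hab⟩ := Quot.exists_rep (e : Sym2 V)
  have hab' : (e : Sym2 V) = s(a, b) := hab.symm
  have hne : a ≠ b := by
    rintro rfl
    have := e.2
    rw [hab'] at this
    exact G.irrefl this
  obtain ⟨s', rfl⟩ := he.2 a (by rw [hab']; exact Sym2.mem_mk_left _ _)
  obtain ⟨j', rfl⟩ := he.2 b (by rw [hab']; exact Sym2.mem_mk_right _ _)
  obtain ⟨q, h1, h2⟩ := (circuit w hw hpos).exists_rep 0 s'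
  obtain ⟨q', h3, h4⟩ := (circuit w hw hpos).exists_rep 0 j'
  rw [← (circuit w hw hpos).v_add_mul_n s' q, ← (circuit w hw hpos).v_add_mul_n j' q'] at hab' hne
  generalize s' + q * (circuit w hw hpos).n = s at *
  generalize j' + q' * (circuit w hw hpos).n = j at *
  rw [circuit_n, zero_add] at h2 h4
  have hsj : s ≠ j := fun hsj => hne (by rw [hsj])
  rcases lt_or_gt_of_ne hsj with hsj | hsj
  · exact ⟨_, _, isOddChordAt_of w hw hpos he hb h1 hsj h4 hab' (h.chord_even e s j he hab')⟩
  · rw [Sym2.eq_swap] at hab'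
    exact ⟨_, _, isOddChordAt_of w hw hpos he hb h3 hsj h2 hab' (h.chord_even e j s he hab')⟩

theorem EvenCircuit.IsRigid.not_crossEffectively (h : (circuit w hw hpos).IsRigid)
    (f f' : Sym2 V) : ¬ CrossEffectively w f f' := by
  rintro ⟨s, j, s', j', ⟨hf, -, h1, h2, h3, -⟩, ⟨hf', -, h4, h5, h6, -⟩, hodd, hcr⟩
  obtain ⟨e, rfl⟩ : ∃ e : G.edgeSet, f = e := ⟨⟨f, hf.1⟩, rfl⟩
  obtain ⟨e', rfl⟩ : ∃ e : G.edgeSet, f' = e := ⟨⟨f', hf'.1⟩, rfl⟩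
  rw [isChord_iff w hw hpos] at hf hf'
  rw [← circuit_v w hw hpos (by omega), ← circuit_v w hw hpos (by omega)] at h3 h6
  rcases hcr with hcr | hcr
  · exact h.chord_cross e e' s j s' j' hf h3 hf' h6 (by omega) (by omega) (by omega)
      (by rw [circuit_n]; omega) hodd
  · refine h.chord_cross e' e s' j' s j hf' h6 hf h3 (by omega) (by omega) (by omega)
      (by rw [circuit_n]; omega) ?_
    rw [← neg_sub]
    exact hodd.neg

theorem isTwoFiber_circuit_iff [Finite V] (hne : expPlus w ≠ expMinus w) :
    (circuit w hw hpos).IsTwoFiber ↔ IsStronglyPrimitive w ∧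
      (∀ f : Sym2 V, IsChord w f → IsOddChord w f) ∧
      ¬ ∃ f f' : Sym2 V, CrossEffectively w f f' := by
  constructor
  · intro hF
    have hp := hF.isPrimitive
    have hr := hF.isRigid (hp.isCactus hw hpos hne)
    refine ⟨(isStronglyPrimitive_iff w hw hpos).2 ⟨hp, hr.hasNoAdjacentSinks⟩,
      fun f hf => hr.isOddChord w hw hpos hf, ?_⟩
    rintro ⟨f, f', h⟩
    exact hr.not_crossEffectively w hw hpos f f' h
  · rintro ⟨hs, hodd, hcross⟩
    exact (isRigid_of_isStronglyPrimitive w hw hpos hne hs hodd hcross).fiber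

end Main

end GraphToric

end

theorem theorem4p14 {V : Type*} [Finite V] (G : SimpleGraph V) (hG : G.Connected)
    (K : Type*) [Field K] {x : V} (w : G.Walk x x) (hw : Even w.length)
    (hB : GraphToric.walkBinomial K w ≠ 0) :
    GraphToric.IsIndispensable (GraphToric.graphIdeal K G) (GraphToric.walkBinomial K w) ↔
      GraphToric.IsStronglyPrimitive w ∧
      (∀ f : Sym2 V, GraphToric.IsChord w f → GraphToric.IsOddChord w f) ∧
      ¬ ∃ f f' : Sym2 V, GraphToric.CrossEffectively w f f' := by
  have hne : GraphToric.expPlus w ≠ GraphToric.expMinus w := by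
    intro h
    exact hB (by rw [GraphToric.walkBinomial, h, sub_self])
  have hpos : 0 < w.length := by
    rw [Nat.pos_iff_ne_zero]
    intro h0
    have h1 := GraphToric.degree_expPlus_add w
    rw [h0, Nat.add_eq_zero_iff, Finsupp.degree_eq_zero_iff, Finsupp.degree_eq_zero_iff] at h1
    exact hne (h1.1.trans h1.2.symm)
  have hdeg := (GraphToric.circuit w hw hpos).aDegree_plus_eq_minus
  rw [← GraphToric.isTwoFiber_circuit_iff w hw hpos hne, GraphToric.graphIdeal,
    GraphToric.walkBinomial]
  rw [GraphToric.circuit_plus, GraphToric.circuit_minus] at hdeg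
  rw [GraphToric.isIndispensable_iff _ hdeg hne, GraphToric.EvenCircuit.IsTwoFiber,
    GraphToric.circuit_plus, GraphToric.circuit_minus]
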